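/- Let $K$ be a number field of degree $d=[K:\mathbb{Q}]$, let $E_1,E_2$ be elliptic curves over $K$ with $j$-invariants $j_1,j_2$, and let $\varphi:E_1\to E_2$ be an isogeny defined over $\overline{\mathbb{Q}}$ (an algebraic closure of $K$). Call $\tau$ in the upper half plane the reduced period ratio of a complex elliptic curve $E$ if it has the smallest real part among all $\tau'$ with $|\tau'|\ge 1$, $|\mathrm{Re}\,\tau'|\le \tfrac12$ and $E(\mathbb{C})\simeq\mathbb{C}/(\mathbb{Z}+\tau'\mathbb{Z})$ (isomorphism of complex Lie groups). For every embedding $\sigma:K\hookrightarrow\mathbb{C}$ let $\tau_{1,\sigma},\tau_{2,\sigma}$ be the reduced period ratios of the complex elliptic curves $E_{1,\sigma}$, $E_{2,\sigma}$ obtained from $E_1,E_2$ through $\sigma$, and put $$\alpha(E_1,E_2)=\frac{1}{2d}\sum_{\sigma:K\hookrightarrow\mathbb{C}}\log\frac{\mathrm{Im}\,\tau_{1,\sigma}}{\mathrm{Im}\,\tau_{2,\sigma}}.$$ Then $$\alpha(E_1,E_2)\le\frac12\log\deg\varphi ,$$ and moreover $$\alpha(E_1,E_2)\le\frac12\log\bigl(1+h(j_1)\bigr)+0.97-\frac12\log(2\pi)-\frac12\log\frac{\sqrt3}{2},$$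 where $h$ denotes the absolute logarithmic Weil height. -/

import Mathlib

open scoped UpperHalfPlane Modular Polynomial

namespace EllipticAlpha

/-! ### Isogenies -/

section Isogeny

variable {F : Type*} [Field F]

/-- The rational function `f` on the Weierstrass curve `W` has a pole at the point at infinity `O`.
For a nonzero element `r` of the coordinate ring `F[W]`, the natural degree of the norm of `r`
down to `F[X]` is the order of the pole of `r` at `O` (it is `2` for `r = x` and `3` for `r = y`).
Hence `f = a / b` has a pole at `O` exactly when the norm of `a` has larger degree than
that of `b`. -/
def HasPoleAtInfinity (W : WeierstrassCurve F) (f : W.toAffine.FunctionField) : Prop :=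
  ∃ a b : W.toAffine.CoordinateRing, b ≠ 0 ∧
    f = algebraMap W.toAffine.CoordinateRing W.toAffine.FunctionField a /
      algebraMap W.toAffine.CoordinateRing W.toAffine.FunctionField b ∧
    (Algebra.norm F[X] b).natDegree < (Algebra.norm F[X] a).natDegree

/-- The coordinate function `x` in the function field of a Weierstrass curve. -/
noncomputable def xFunction (W : WeierstrassCurve F) : W.toAffine.FunctionField :=
  algebraMap W.toAffine.CoordinateRing W.toAffine.FunctionField
    (WeierstrassCurve.Affine.CoordinateRing.mk W.toAffine (Polynomial.C Polynomial.X))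

/-- An isogeny `φ : W₁ → W₂` of elliptic curves over `F`: a nonconstant morphism of curves over `F`
with `φ(O) = O`.  A nonconstant morphism of smooth projective curves is the same thing as an
`F`-embedding `φ^* : F(W₂) → F(W₁)` of function fields.  Since the only pole of the function `x` on
`W₂` is `O`, the condition `φ(O) = O` says that `φ^* x` has a pole at `O`. -/
structure Isogeny (W₁ W₂ : WeierstrassCurve F) where
  /-- The pullback of functions along the isogeny. -/
  pullback : W₂.toAffine.FunctionField →ₐ[F] W₁.toAffine.FunctionField
  /-- The isogeny sends the origin to the origin. -/
  map_origin : HasPoleAtInfinity W₁ (pullback (xFunction W₂))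

/-- The degree `[F(W₁) : φ^* F(W₂)]` of an isogeny `φ : W₁ → W₂`. -/
noncomputable def Isogeny.degree {W₁ W₂ : WeierstrassCurve F} (φ : Isogeny W₁ W₂) : ℕ :=
  Module.finrank φ.pullback.fieldRange W₁.toAffine.FunctionField

end Isogeny

/-! ### Reduced period ratios -/

/-- The lattice `ℤ + τℤ` in `ℂ`. -/
def lattice (τ : ℍ) : AddSubgroup ℂ := AddSubgroup.closure {1, (τ : ℂ)}

open Classical in
/-- `E(ℂ) ≃ ℂ / (ℤ + τℤ)` as complex Lie groups: there is an isomorphism of groups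
`e : ℂ / (ℤ + τℤ) ≃ E(ℂ)` whose affine coordinates are holomorphic functions on the complement of
the lattice (the lattice itself goes to the point at infinity).
As `e` is compatible with translations, it is then holomorphic everywhere, and a holomorphic
bijection of Riemann surfaces is biholomorphic. -/
def IsUniformizedBy (E : WeierstrassCurve ℂ) (τ : ℍ) : Prop :=
  ∃ (e : (ℂ ⧸ lattice τ) ≃+ E.toAffine.Point) (X Y : ℂ → ℂ),
    DifferentiableOn ℂ X (lattice τ : Set ℂ)ᶜ ∧ DifferentiableOn ℂ Y (lattice τ : Set ℂ)ᶜ ∧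
    ∀ z : ℂ, z ∉ lattice τ →
      ∃ h : E.toAffine.Nonsingular (X z) (Y z),
        e (QuotientAddGroup.mk z) = WeierstrassCurve.Affine.Point.some (X z) (Y z) h

/-- `τ` is the reduced period ratio of the complex elliptic curve `E`: among the points `τ'` of the
closed fundamental domain `{|τ'| ≥ 1, |Re τ'| ≤ 1/2}` such that `E(ℂ) ≃ ℂ / (ℤ + τ'ℤ)`,
it is the one with smallest real part. -/
def IsReducedFor (E : WeierstrassCurve ℂ) (τ : ℍ) : Prop :=
  τ ∈ 𝒟 ∧ IsUniformizedBy E τ ∧ ∀ τ' : ℍ, τ' ∈ 𝒟 → IsUniformizedBy E τ' → τ.re ≤ τ'.re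

section NumberField

variable {K : Type*} [Field K] [NumberField K]

/-- The quantity `(1 / (2 [K : ℚ])) ∑_σ log (Im τ_{1,σ} / Im τ_{2,σ})`, the sum being over all
complex embeddings `σ` of `K`.  It is `α(E₁, E₂)` when `τ_{i,σ}` is the reduced period ratio of
`E_i` with respect to `σ`. -/
noncomputable def alpha (τ₁ τ₂ : (K →+* ℂ) → ℍ) : ℝ :=
  1 / (2 * (Module.finrank ℚ K : ℝ)) * ∑ σ : K →+* ℂ, Real.log ((τ₁ σ).im / (τ₂ σ).im)

/-- The absolute logarithmic Weil height of an element of the number field `K`.  In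
`Height.logHeight₁` every place `v` of `K` is weighted by its local degree. -/
noncomputable def weilHeight (x : K) : ℝ :=
  1 / (Module.finrank ℚ K : ℝ) * Height.logHeight₁ x

end NumberField

end EllipticAlpha

namespace EllipticAlpha

open Filter Topology

/-! ### Meromorphic functions on the plane, up to codiscrete sets -/

/-! Both bounds are proved one embedding at a time and then averaged.

For the first, write the complex curves as ℂ/Λ₁ and ℂ/Λ₂ with Λᵢ = ℤ + τᵢℤ. The isogeny lifts to an
affine map z ↦ αz + β with αΛ₁ ⊆ Λ₂ (`exists_lift`, `mul_mem_lattice_of_lift`), because the pullback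
of the invariant differential is holomorphic and doubly periodic, hence constant. Comparing
covolumes gives |α|² Im τ₁ = [Λ₂ : αΛ₁] Im τ₂. The index is at most deg φ: translations by α⁻¹Λ₂/Λ₁
give distinct embeddings of the function field that agree on the pulled-back subfield
(`card_le_degree_of_lift`). Finally α = α·1 is a nonzero element of Λ₂, so |α| ≥ 1 because τ₂ lies
in the fundamental domain (`one_le_normSq_of_mem_fd`). Hence Im τ₁ / Im τ₂ ≤ deg φ (`im_div_im_le`).

For the second, Im τ₂ ≥ √3/2, while j ~ 1/q near the cusp yields 2π Im τ₁ ≤ e^1.94 (1 + log⁺|j|)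
(`two_pi_im_le`). To reach this, the uniformization is compared with ℘, which expresses j through
Eisenstein series (`j_mul_eq`). Concavity of log and the bound of the average of log⁺|σ(j₁)| by the
height finish the proof (`alpha_le_log_height`). -/

lemma eventually_codiscrete_iff {p : ℂ → Prop} :
    (∀ᶠ z in codiscrete ℂ, p z) ↔ ∀ x, ∀ᶠ z in 𝓝[≠] x, p z := by
  simp only [Filter.Eventually, codiscrete, mem_codiscreteWithin_iff_forall_mem_nhdsNE]
  simp

lemma eventually_codiscrete_affine {p : ℂ → Prop} {α : ℂ} (hα : α ≠ 0) (β : ℂ)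
    (h : ∀ᶠ z in codiscrete ℂ, p z) : ∀ᶠ z in codiscrete ℂ, p (α * z + β) := by
  rw [eventually_codiscrete_iff] at h ⊢
  intro x
  have h1 : Tendsto (fun z : ℂ => α * z + β) (𝓝[≠] x) (𝓝[≠] (α * x + β)) := by
    refine tendsto_nhdsWithin_of_tendsto_nhds_of_eventually_within _ ?_ ?_
    · exact ((continuous_const.mul continuous_id).add continuous_const).continuousAt.tendsto.mono_left
        nhdsWithin_le_nhds
    · filter_upwards [self_mem_nhdsWithin] with z hz
      simpa [hα] using hz
  exact h1.eventually (h _)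

lemma eventually_codiscrete_add {p : ℂ → Prop} (β : ℂ)
    (h : ∀ᶠ z in codiscrete ℂ, p z) : ∀ᶠ z in codiscrete ℂ, p (z + β) := by
  simpa using eventually_codiscrete_affine one_ne_zero β h

lemma countable_not_of_eventually_codiscrete {p : ℂ → Prop}
    (h : ∀ᶠ z in codiscrete ℂ, p z) : {z | ¬ p z}.Countable := by
  apply (HereditarilyLindelofSpace.isLindelof _).countable_of_isDiscrete
  have := isDiscrete_of_codiscreteWithin (U := Set.univ) (s := {z | ¬ p z}) (by
    rw [show {z | ¬ p z}ᶜ = {z | p z} by ext z; simp]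
    exact h)
  simpa using this

lemma exists_of_countable_not {p : ℂ → Prop} (h : {z | ¬ p z}.Countable) : ∃ z, p z := by
  by_contra! hc
  have : {z : ℂ | ¬ p z} = Set.univ := by ext z; simp [hc z]
  rw [this] at h
  exact not_countable_complex h

/-- Identity theorem: since ℂ is connected, the order is infinite at every point or at none. Values
of meromorphic functions at isolated points carry no meaning, so identities are stated off a
codiscrete set. -/
lemma eventually_eq_zero_or_ne_zero {f : ℂ → ℂ} (hf : Meromorphic f) :
    (∀ᶠ z in codiscrete ℂ, f z = 0) ∨ (∀ᶠ z in codiscrete ℂ, f z ≠ 0) := by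
  simp only [eventually_codiscrete_iff]
  by_cases h : ∃ x, meromorphicOrderAt f x ≠ ⊤
  · right
    obtain ⟨x, hx⟩ := h
    intro y
    refine (meromorphicOrderAt_ne_top_iff_eventually_ne_zero (hf y)).1 ?_
    exact (hf.meromorphicOn (s := Set.univ)).meromorphicOrderAt_ne_top_of_isPreconnected
      isPreconnected_univ (Set.mem_univ x) (Set.mem_univ y) hx
  · left
    push Not at h
    exact fun x => meromorphicOrderAt_eq_top_iff.1 (h x)

lemma eventually_eq_of_frequently {f g : ℂ → ℂ} (hf : Meromorphic f) (hg : Meromorphic g) {x : ℂ}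
    (h : ∃ᶠ z in 𝓝[≠] x, f z = g z) : ∀ᶠ z in codiscrete ℂ, f z = g z := by
  rcases eventually_eq_zero_or_ne_zero (hf.sub hg) with h1 | h1
  · filter_upwards [h1] with z hz
    simpa [sub_eq_zero] using hz
  · exfalso
    refine h ?_
    filter_upwards [eventually_codiscrete_iff.1 h1 x] with z hz
    simpa [sub_eq_zero] using hz

/-- Genericity over a countable field excludes a countable, possibly dense, set of points. Two
cocountable sets still meet, so the identity theorem applies. -/
lemma eventually_eq_of_countable {f g : ℂ → ℂ} (hf : Meromorphic f) (hg : Meromorphic g)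
    (h : {z | ¬ f z = g z}.Countable) : ∀ᶠ z in codiscrete ℂ, f z = g z := by
  rcases eventually_eq_zero_or_ne_zero (hf.sub hg) with h1 | h1
  · filter_upwards [h1] with z hz
    simpa [sub_eq_zero] using hz
  · exfalso
    have h2 := countable_not_of_eventually_codiscrete h1
    obtain ⟨z, hz⟩ := exists_of_countable_not (p := fun z => f z = g z ∧ (f - g) z ≠ 0) (by
      refine (h.union h2).mono ?_
      intro z hz
      simp only [Set.mem_ofPred_eq, not_and_or] at hz
      exact hz)
    exact hz.2 (by simp [hz.1])

lemma eventually_deriv_eq {f g : ℂ → ℂ} (h : ∀ᶠ z in codiscrete ℂ, f z = g z) :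
    ∀ᶠ z in codiscrete ℂ, deriv f z = deriv g z := by
  rw [eventually_codiscrete_iff] at h ⊢
  intro x
  exact EventuallyEq.nhdsNE_deriv (h x)

lemma eventually_analyticAt {f : ℂ → ℂ} (hf : Meromorphic f) :
    ∀ᶠ z in codiscrete ℂ, AnalyticAt ℂ f z :=
  eventually_codiscrete_iff.2 fun x => (hf x).eventually_analyticAt

/-- An identity between continuous functions which holds off a codiscrete set extends. -/
lemma eq_of_eventually_codiscrete {f g : ℂ → ℂ} {x : ℂ} (hf : ContinuousAt f x)
    (hg : ContinuousAt g x) (h : ∀ᶠ z in codiscrete ℂ, f z = g z) : f x = g x := by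
  have h1 := eventually_codiscrete_iff.1 h x
  exact tendsto_nhds_unique_of_eventuallyEq (hf.tendsto.mono_left nhdsWithin_le_nhds)
    (hg.tendsto.mono_left nhdsWithin_le_nhds) h1

lemma eventually_codiscrete_comm {p : ℂ → Prop} (h : ∀ᶠ z in codiscrete ℂ, p z) :
    ∀ᶠ z in codiscrete ℂ, ∀ᶠ w in 𝓝 z, p w := by
  rw [eventually_codiscrete_iff] at h ⊢
  intro x
  have := eventually_eventually_nhdsWithin.2 (h x)
  filter_upwards [this, self_mem_nhdsWithin] with z hz hzx
  rwa [(isOpen_compl_singleton (x := x)).nhdsWithin_eq hzx] at hz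

/-! ### Lattices -/

/-- The pair of periods `(1, τ)`. -/
noncomputable def periods (τ : ℍ) : PeriodPair where
  ω₁ := 1
  ω₂ := τ
  indep := by
    rw [LinearIndependent.pair_iff]
    intro s t h
    have h1 := congrArg Complex.im h
    have h2 := congrArg Complex.re h
    have : (τ : ℂ).im ≠ 0 := τ.im_ne_zero
    simp at h1
    have ht : t = 0 := by tauto
    subst ht
    simpa using h2

lemma mem_lattice_iff {τ : ℍ} {z : ℂ} : z ∈ lattice τ ↔ ∃ m n : ℤ, (m : ℂ) + n * τ = z := by
  rw [lattice, AddSubgroup.mem_closure_pair]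
  simp

lemma mem_periods_lattice {τ : ℍ} {z : ℂ} : z ∈ (periods τ).lattice ↔ z ∈ lattice τ := by
  rw [mem_lattice_iff, PeriodPair.mem_lattice]
  simp [periods]

lemma coe_periods_lattice (τ : ℍ) : ((periods τ).lattice : Set ℂ) = (lattice τ : Set ℂ) := by
  ext z; exact mem_periods_lattice

lemma isClosed_lattice (τ : ℍ) : IsClosed (lattice τ : Set ℂ) := by
  rw [← coe_periods_lattice]; exact (periods τ).isClosed_lattice

lemma eventually_notMem_lattice (τ : ℍ) : ∀ᶠ z in codiscrete ℂ, z ∉ lattice τ := by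
  rw [eventually_codiscrete_iff]
  intro x
  filter_upwards [self_mem_nhdsWithin, mem_nhdsWithin_of_mem_nhds
    ((periods τ).compl_lattice_sdiff_singleton_mem_nhds x)] with w hw hw'
  rw [← mem_periods_lattice]
  simp_all

lemma eventually_nhds_notMem_lattice {τ : ℍ} {x : ℂ} (hx : x ∉ lattice τ) :
    ∀ᶠ z in 𝓝 x, z ∉ lattice τ :=
  (isClosed_lattice τ).isOpen_compl.mem_nhds hx

/-- A doubly periodic meromorphic function without poles is constant. -/
lemma exists_eq_const_of_periodic (τ : ℍ) {f : ℂ → ℂ} (hf : Meromorphic f)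
    (hord : ∀ x, 0 ≤ meromorphicOrderAt f x)
    (hper : ∀ l ∈ lattice τ, ∀ᶠ z in codiscrete ℂ, f (z + l) = f z) :
    ∃ c, ∀ᶠ z in codiscrete ℂ, f z = c := by
  have hfo : MeromorphicOn f Set.univ := hf.meromorphicOn
  -- The normal form fills in the removable singularities. The result is entire and periodic, hence
  -- bounded, and Liouville applies.
  set F := toMeromorphicNFOn f Set.univ with hF
  have hFf : ∀ᶠ z in codiscrete ℂ, f z = F z := toMeromorphicNFOn_eqOn_codiscrete hfo
  have hFa : ∀ x, AnalyticAt ℂ F x := fun x => by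
    rw [← (meromorphicNFOn_toMeromorphicNFOn f Set.univ (Set.mem_univ x)).meromorphicOrderAt_nonneg_iff_analyticAt,
      meromorphicOrderAt_toMeromorphicNFOn hfo (Set.mem_univ x)]
    exact hord x
  have hFd : Differentiable ℂ F := fun x => (hFa x).differentiableAt
  have hFp : ∀ z, ∀ l ∈ (periods τ).lattice, F (z + l) = F z := by
    intro z l hl
    rw [mem_periods_lattice] at hl
    refine eq_of_eventually_codiscrete (f := fun z => F (z + l)) (g := F) ?_ ?_ ?_
    · exact (hFd.continuous.comp (continuous_id.add continuous_const)).continuousAt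
    · exact hFd.continuous.continuousAt
    · filter_upwards [hFf, hper l hl, eventually_codiscrete_add l hFf] with w h1 h2 h3
      rw [← h3, h2, h1]
  refine ⟨F 0, ?_⟩
  filter_upwards [hFf] with z hz
  rw [hz]
  exact hFd.apply_eq_apply_of_bounded (IsZLattice.isCompact_range_of_periodic (periods τ).lattice _
    hFd.continuous hFp).isBounded z 0

/-! ### The invariant differential of a curve `v² = 4u³ - g₂u - g₃` -/

lemma deriv_of_weierstrass_eq {g₂ g₃ : ℂ} {u v : ℂ → ℂ} {p : ℂ} (hu : AnalyticAt ℂ u p)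
    (hv : AnalyticAt ℂ v p) (h : ∀ᶠ z in 𝓝 p, v z ^ 2 = 4 * u z ^ 3 - g₂ * u z - g₃) :
    2 * v p * deriv v p = (12 * u p ^ 2 - g₂) * deriv u p := by
  have h1 := EventuallyEq.deriv_eq h
  have hu' := hu.differentiableAt.hasDerivAt
  have hv' := hv.differentiableAt.hasDerivAt
  have h2 : HasDerivAt (fun z => v z ^ 2) (2 * v p * deriv v p) p := by
    simpa using hv'.fun_pow 2
  have h3 : HasDerivAt (fun z => 4 * u z ^ 3 - g₂ * u z - g₃)
      (4 * (3 * u p ^ 2 * deriv u p) - g₂ * deriv u p) p := by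
    simpa using ((((hu'.fun_pow 3).const_mul 4).sub (hu'.const_mul g₂)).sub_const g₃)
  rw [h2.deriv, h3.deriv] at h1
  rw [h1]; ring

lemma exists_analyticAt_of_order_nonneg {g₂ g₃ : ℂ} (hΔ : g₂ ^ 3 - 27 * g₃ ^ 2 ≠ 0)
    {u v : ℂ → ℂ} {p : ℂ} (hu : MeromorphicAt u p) (hv : MeromorphicAt v p)
    (h : ∀ᶠ z in 𝓝[≠] p, v z ^ 2 = 4 * u z ^ 3 - g₂ * u z - g₃)
    (hord : 0 ≤ meromorphicOrderAt u p) :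
    ∃ g, AnalyticAt ℂ g p ∧ ∀ᶠ z in 𝓝[≠] p, deriv u z = g z * v z := by
  have hua := (hu.meromorphicOrderAt_nonneg_iff_analyticAt_toMeromorphicNFAt).1 hord
  have hue := hu.eq_nhdsNE_toMeromorphicNFAt
  set U := toMeromorphicNFAt u p
  have hordv : 0 ≤ meromorphicOrderAt v p := by
    have h1 : (v ^ 2) =ᶠ[𝓝[≠] p] fun z => 4 * U z ^ 3 - g₂ * U z - g₃ := by
      filter_upwards [h, hue] with z h1 h2
      rw [← h2]; simpa using h1
    have h2 : 0 ≤ meromorphicOrderAt (v ^ 2) p := by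
      rw [meromorphicOrderAt_congr h1]
      exact AnalyticAt.meromorphicOrderAt_nonneg (by fun_prop)
    rw [meromorphicOrderAt_pow hv] at h2
    induction hm : meromorphicOrderAt v p with
    | top => simp
    | coe k =>
      rw [hm, show ((2 : ℕ) : WithTop ℤ) = ((2 : ℤ) : WithTop ℤ) from rfl, ← WithTop.coe_mul,
        WithTop.coe_nonneg] at h2
      rw [WithTop.coe_nonneg]
      omega
  have hva := (hv.meromorphicOrderAt_nonneg_iff_analyticAt_toMeromorphicNFAt).1 hordv
  have hve := hv.eq_nhdsNE_toMeromorphicNFAt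
  set V := toMeromorphicNFAt v p
  have hUV : ∀ᶠ z in 𝓝 p, V z ^ 2 = 4 * U z ^ 3 - g₂ * U z - g₃ := by
    have h1 : (fun z => V z ^ 2) =ᶠ[𝓝[≠] p] fun z => 4 * U z ^ 3 - g₂ * U z - g₃ := by
      filter_upwards [h, hue, hve] with z h1 h2 h3
      rw [← h2, ← h3, h1]
    exact (ContinuousAt.eventuallyEq_nhds_iff_eventuallyEq_nhdsNE (hva.pow 2).continuousAt
      (by fun_prop)).1 h1
  have hder : ∀ᶠ z in 𝓝 p, 2 * V z * deriv V z = (12 * U z ^ 2 - g₂) * deriv U z := by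
    filter_upwards [hua.eventually_analyticAt, hva.eventually_analyticAt,
      eventually_eventually_nhds.2 hUV] with z h1 h2 h3
    exact deriv_of_weierstrass_eq h1 h2 h3
  have hdu : deriv u =ᶠ[𝓝[≠] p] deriv U := EventuallyEq.nhdsNE_deriv hue
  by_cases hV0 : V p = 0
  -- At a zero of v the quotient u'/v is rewritten by means of 2vv' = (12u² - g₂)u'. If the factor
  -- 12u² - g₂ vanished too, the cubic would have a double root and its discriminant would be zero.
  · have hne : 12 * U p ^ 2 - g₂ ≠ 0 := by
      intro h0
      have h1 := hUV.self_of_nhds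
      rw [hV0] at h1
      have h2 : g₂ = 12 * U p ^ 2 := by linear_combination -h0
      have h3 : g₃ = -8 * U p ^ 3 := by
        linear_combination h1 - U p * h2
      apply hΔ
      rw [h2, h3]; ring
    refine ⟨fun z => 2 * deriv V z / (12 * U z ^ 2 - g₂),
      (analyticAt_const.mul hva.deriv).fun_div (by fun_prop) hne, ?_⟩
    have hne' : ∀ᶠ z in 𝓝 p, 12 * U z ^ 2 - g₂ ≠ 0 :=
      ContinuousAt.eventually_ne (by fun_prop) hne
    filter_upwards [hdu, hve, nhdsWithin_le_nhds hder, nhdsWithin_le_nhds hne'] with z h1 h2 h3 h4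
    rw [h1, h2]
    field_simp
    linear_combination -h3
  · refine ⟨fun z => deriv U z / V z, hua.deriv.fun_div hva hV0, ?_⟩
    have hne' : ∀ᶠ z in 𝓝 p, V z ≠ 0 := ContinuousAt.eventually_ne hva.continuousAt hV0
    filter_upwards [hdu, hve, nhdsWithin_le_nhds hne'] with z h1 h2 h4
    rw [h1, h2]
    field_simp

/-- At a pole of u, v² = u³ · w with w = 4 - g₂u⁻² - g₃u⁻³ tending to 4, so w has order 0. -/
lemma order_of_weierstrass_eq {g₂ g₃ : ℂ} {u v : ℂ → ℂ} {p : ℂ} (hu : MeromorphicAt u p)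
    (hv : MeromorphicAt v p) (h : ∀ᶠ z in 𝓝[≠] p, v z ^ 2 = 4 * u z ^ 3 - g₂ * u z - g₃) {n : ℤ}
    (hord : meromorphicOrderAt u p = n) (hn : n < 0) :
    ∃ k : ℤ, meromorphicOrderAt v p = k ∧ 2 * k = 3 * n := by
  have hneg : meromorphicOrderAt u p < 0 := by rw [hord]; exact_mod_cast hn
  have hinv : Tendsto (fun z => (u z)⁻¹) (𝓝[≠] p) (𝓝 0) :=
    tendsto_inv₀_cobounded.comp (tendsto_cobounded_of_meromorphicOrderAt_neg hneg)
  have hne : ∀ᶠ z in 𝓝[≠] p, u z ≠ 0 :=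
    (meromorphicOrderAt_ne_top_iff_eventually_ne_zero hu).1 (by rw [hord]; simp)
  set w : ℂ → ℂ := fun z => 4 - g₂ * (u z)⁻¹ ^ 2 - g₃ * (u z)⁻¹ ^ 3
  have hw : MeromorphicAt w p := by fun_prop
  have hw0 : meromorphicOrderAt w p = 0 := by
    rw [← tendsto_ne_zero_iff_meromorphicOrderAt_eq_zero hw]
    refine ⟨4, by norm_num, ?_⟩
    have := ((tendsto_const_nhds (x := (4 : ℂ))).sub ((hinv.pow 2).const_mul g₂)).sub
      ((hinv.pow 3).const_mul g₃)
    convert this using 2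
    simp
  have he : (v ^ 2) =ᶠ[𝓝[≠] p] u ^ 3 * w := by
    filter_upwards [h, hne] with z h1 h2
    simp only [Pi.pow_apply, Pi.mul_apply, h1, w]
    field_simp
  have h2 := meromorphicOrderAt_congr he
  rw [meromorphicOrderAt_pow hv, meromorphicOrderAt_mul (hu.pow 3) hw,
    meromorphicOrderAt_pow hu, hw0, hord, add_zero] at h2
  induction hm : meromorphicOrderAt v p with
  | top =>
    rw [hm] at h2
    norm_cast at h2
  | coe k =>
    rw [hm, show ((2 : ℕ) : WithTop ℤ) = ((2 : ℤ) : WithTop ℤ) from rfl, ← WithTop.coe_mul,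
      show ((3 : ℕ) : WithTop ℤ) = ((3 : ℤ) : WithTop ℤ) from rfl, ← WithTop.coe_mul,
      WithTop.coe_inj] at h2
    exact ⟨k, rfl, h2⟩

/-- The differential `du / v` is holomorphic. -/
lemma exists_analyticAt_deriv_eq_mul {g₂ g₃ : ℂ} (hΔ : g₂ ^ 3 - 27 * g₃ ^ 2 ≠ 0)
    {u v : ℂ → ℂ} {p : ℂ} (hu : MeromorphicAt u p) (hv : MeromorphicAt v p)
    (h : ∀ᶠ z in 𝓝[≠] p, v z ^ 2 = 4 * u z ^ 3 - g₂ * u z - g₃) :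
    ∃ g, AnalyticAt ℂ g p ∧ ∀ᶠ z in 𝓝[≠] p, deriv u z = g z * v z := by
  rcases le_or_gt 0 (meromorphicOrderAt u p) with hord | hord
  · exact exists_analyticAt_of_order_nonneg hΔ hu hv h hord
  obtain ⟨n, hn⟩ := WithTop.ne_top_iff_exists.1 (ne_top_of_lt hord)
  have hn0 : n < 0 := by rw [← hn] at hord; exact_mod_cast hord
  obtain ⟨k, hk, hkn⟩ := order_of_weierstrass_eq hu hv h hn.symm hn0
  have hd : meromorphicOrderAt (deriv u) p = ((n - 1 : ℤ) : WithTop ℤ) :=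
    meromorphicOrderAt_deriv_eq_sub_one (by exact_mod_cast hn0.ne) hn.symm
  have hm : MeromorphicAt (deriv u / v) p := hu.deriv.div hv
  -- The order is (n - 1) - 3n/2 = -n/2 - 1, and n is even and negative.
  have ho : 0 ≤ meromorphicOrderAt (deriv u / v) p := by
    rw [meromorphicOrderAt_div hu.deriv hv, hd, hk]
    norm_cast
    omega
  have hve : ∀ᶠ z in 𝓝[≠] p, v z ≠ 0 :=
    (meromorphicOrderAt_ne_top_iff_eventually_ne_zero hv).1 (by rw [hk]; simp)
  refine ⟨toMeromorphicNFAt (deriv u / v) p,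
    (hm.meromorphicOrderAt_nonneg_iff_analyticAt_toMeromorphicNFAt).1 ho, ?_⟩
  filter_upwards [hm.eq_nhdsNE_toMeromorphicNFAt, hve] with z h1 h2
  rw [← h1]
  simp [h2]

/-- Doubly periodic parametrizations of an elliptic curve have constant invariant differential. -/
lemma exists_const_deriv_eq_mul {g₂ g₃ : ℂ} (hΔ : g₂ ^ 3 - 27 * g₃ ^ 2 ≠ 0) (τ : ℍ)
    {u v : ℂ → ℂ} (hu : Meromorphic u) (hv : Meromorphic v)
    (h : ∀ᶠ z in codiscrete ℂ, v z ^ 2 = 4 * u z ^ 3 - g₂ * u z - g₃)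
    (hv0 : ∀ᶠ z in codiscrete ℂ, v z ≠ 0)
    (hpu : ∀ l ∈ lattice τ, ∀ᶠ z in codiscrete ℂ, u (z + l) = u z)
    (hpv : ∀ l ∈ lattice τ, ∀ᶠ z in codiscrete ℂ, v (z + l) = v z) :
    ∃ c, ∀ᶠ z in codiscrete ℂ, deriv u z = c * v z := by
  have hw : Meromorphic (deriv u / v) := hu.deriv.div hv
  have hord : ∀ x, 0 ≤ meromorphicOrderAt (deriv u / v) x := by
    intro x
    obtain ⟨g, hg, hge⟩ := exists_analyticAt_deriv_eq_mul hΔ (hu x) (hv x)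
      (eventually_codiscrete_iff.1 h x)
    rw [meromorphicOrderAt_congr (f₂ := g)]
    · exact hg.meromorphicOrderAt_nonneg
    · filter_upwards [hge, eventually_codiscrete_iff.1 hv0 x] with z h1 h2
      simp [h1, h2]
  obtain ⟨c, hc⟩ := exists_eq_const_of_periodic τ hw hord (by
    intro l hl
    have h1 := eventually_deriv_eq (hpu l hl)
    filter_upwards [h1, hpv l hl] with z h1 h2
    rw [deriv_comp_add_const] at h1
    simp [h1, h2])
  refine ⟨c, ?_⟩
  filter_upwards [hc, hv0] with z h1 h2
  rw [← h1]
  simp [h2]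

/-- A holomorphic solution of `d' = g d` with `d(p) = 0` vanishes near `p`. -/
lemma eventually_eq_zero_of_deriv_eq_mul {d g : ℂ → ℂ} {p : ℂ} (hd : AnalyticAt ℂ d p)
    (hg : AnalyticAt ℂ g p) (h0 : d p = 0) (h : ∀ᶠ z in 𝓝 p, deriv d z = g z * d z) :
    ∀ᶠ z in 𝓝 p, d z = 0 := by
  rw [← analyticOrderAt_eq_top]
  by_contra htop
  obtain ⟨n, hn⟩ := ENat.ne_top_iff_exists.1 htop
  have hn0 : n ≠ 0 := by
    rintro rfl
    exact (analyticOrderAt_ne_zero.2 ⟨hd, h0⟩) hn.symm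
  have ho : meromorphicOrderAt d p = ((n : ℤ) : WithTop ℤ) := by
    rw [hd.meromorphicOrderAt_eq, ← hn]; rfl
  -- A finite order n ≥ 1 is impossible: the left side has order n - 1, the right side at least n.
  have h1 := meromorphicOrderAt_deriv_eq_sub_one (by exact_mod_cast hn0) ho
  have h2 : meromorphicOrderAt (deriv d) p = meromorphicOrderAt (g * d) p :=
    meromorphicOrderAt_congr (by
      filter_upwards [nhdsWithin_le_nhds h] with z hz
      simpa using hz)
  rw [h1, meromorphicOrderAt_mul hg.meromorphicAt hd.meromorphicAt, ho] at h2
  have h3 := hg.meromorphicOrderAt_nonneg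
  induction hm : meromorphicOrderAt g p with
  | top => rw [hm] at h2; norm_cast at h2
  | coe k =>
    rw [hm] at h2 h3
    rw [← WithTop.coe_add, WithTop.coe_inj] at h2
    rw [WithTop.coe_nonneg] at h3
    omega

/-- Two doubly periodic parametrizations of an elliptic curve with proportional differentials
differ by an affine map. -/
lemma exists_affine_of_deriv_eq_mul {g₂ g₃ κ c : ℂ} (hc : c ≠ 0) {u v U V : ℂ → ℂ} {S : Set ℂ}
    (hu : Meromorphic u) (hv : Meromorphic v) (hU : Meromorphic U) (hV : Meromorphic V)
    (huv : ∀ᶠ z in codiscrete ℂ, v z ^ 2 = 4 * u z ^ 3 - g₂ * u z - g₃)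
    (hv0 : ∀ᶠ z in codiscrete ℂ, v z ≠ 0)
    (hdu : ∀ᶠ z in codiscrete ℂ, deriv u z = κ * v z)
    (hUa : ∀ z ∈ S, AnalyticAt ℂ U z) (hVa : ∀ z ∈ S, AnalyticAt ℂ V z)
    (hUV : ∀ z ∈ S, ∀ᶠ w in 𝓝 z, V w ^ 2 = 4 * U w ^ 3 - g₂ * U w - g₃)
    (hdU : ∀ z ∈ S, ∀ᶠ w in 𝓝 z, deriv U w = c * V w)
    (hsurj : ∀ x y, y ^ 2 = 4 * x ^ 3 - g₂ * x - g₃ → ∃ z ∈ S, U z = x ∧ V z = y) :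
    ∃ β, (κ = 0 → β ∈ S) ∧
      (∀ᶠ z in codiscrete ℂ, u z = U (κ / c * z + β) ∧ v z = V (κ / c * z + β)) := by
  obtain ⟨z₀, ⟨hz1, hz2, hz3, hz4, hz5⟩⟩ := exists_of_countable_not
    (countable_not_of_eventually_codiscrete ((eventually_analyticAt hu).and
      ((eventually_analyticAt hv).and ((eventually_codiscrete_comm huv).and
        (hv0.and (eventually_codiscrete_comm hdu))))))
  -- Both parametrizations pass through the same point, at z₀ and at w₀. The affine map is
  -- normalized to send z₀ to w₀, and uniqueness for the differential equation does the rest.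
  obtain ⟨w₀, hw₀, hUw, hVw⟩ := hsurj _ _ hz3.self_of_nhds
  set α := κ / c with hα
  set β := w₀ - α * z₀ with hβ
  have hβw : α * z₀ + β = w₀ := by rw [hβ]; ring
  set A : ℂ → ℂ := fun z => α * z + β with hA
  have hAa : ∀ z, AnalyticAt ℂ A z := fun z => by fun_prop
  have hAt : Tendsto A (𝓝 z₀) (𝓝 w₀) := by
    rw [← hβw]; exact (hAa z₀).continuousAt.tendsto
  have hUA : AnalyticAt ℂ (U ∘ A) z₀ := AnalyticAt.comp_of_eq (hUa _ hw₀) (hAa _) hβw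
  have hVA : AnalyticAt ℂ (V ∘ A) z₀ := AnalyticAt.comp_of_eq (hVa _ hw₀) (hAa _) hβw
  have hUVA : ∀ᶠ z in 𝓝 z₀, (V ∘ A) z ^ 2 = 4 * (U ∘ A) z ^ 3 - g₂ * (U ∘ A) z - g₃ :=
    hAt.eventually (hUV w₀ hw₀)
  have hdUA : ∀ᶠ z in 𝓝 z₀, deriv (U ∘ A) z = κ * (V ∘ A) z := by
    filter_upwards [hAt.eventually (hdU w₀ hw₀),
      hAt.eventually (hUa w₀ hw₀).eventually_analyticAt] with z h1 h2
    have h3 : HasDerivAt A α z := by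
      have := ((hasDerivAt_id z).const_mul α).add_const β
      rwa [mul_one] at this
    have := (h2.differentiableAt.hasDerivAt.comp z h3).deriv
    rw [this, h1, hα, Function.comp_apply]
    field_simp
  have hU0 : (U ∘ A) z₀ = u z₀ := by simp [hA, hβw, hUw]
  have hV0 : (V ∘ A) z₀ = v z₀ := by simp [hA, hβw, hVw]
  -- Subtracting the two cubic equations and factoring gives v - V = Q · (u - U) wherever v + V ≠ 0;
  -- this makes the difference u - U solve a linear equation.
  set Q : ℂ → ℂ := fun z =>
    (4 * (u z ^ 2 + u z * (U ∘ A) z + (U ∘ A) z ^ 2) - g₂) / (v z + (V ∘ A) z)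
  have hvV : v z₀ + (V ∘ A) z₀ ≠ 0 := by
    rw [hV0, ← two_mul]; exact mul_ne_zero two_ne_zero hz4
  have hQ : AnalyticAt ℂ Q z₀ := by
    exact AnalyticAt.fun_div ((analyticAt_const.mul (((hz1.pow 2).add (hz1.mul hUA)).add
      (hUA.pow 2))).sub analyticAt_const) (hz2.add hVA) hvV
  have hvVe : ∀ᶠ z in 𝓝 z₀, v z + (V ∘ A) z ≠ 0 :=
    (hz2.continuousAt.add hVA.continuousAt).eventually_ne hvV
  have hkey : ∀ᶠ z in 𝓝 z₀, v z - (V ∘ A) z = Q z * (u z - (U ∘ A) z) := by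
    filter_upwards [hvVe, hz3, hUVA] with z h1 h2 h3
    simp only [Q]
    field_simp
    linear_combination h2 - h3
  have hzero := eventually_eq_zero_of_deriv_eq_mul (d := u - U ∘ A) (g := fun z => κ * Q z)
    (hz1.sub hUA) (by fun_prop) (by rw [Pi.sub_apply, hU0, sub_self]) (by
      filter_upwards [hz1.eventually_analyticAt, hUA.eventually_analyticAt, hz5, hdUA, hkey]
        with z h1 h2 h3 h4 h5
      rw [deriv_sub h1.differentiableAt h2.differentiableAt, h3, h4, ← mul_sub, h5]
      simp only [Pi.sub_apply]
      ring)
  have hUm : Meromorphic (U ∘ A) := by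
    intro z
    exact (hU (A z)).comp_analyticAt (hAa z)
  have hVm : Meromorphic (V ∘ A) := by
    intro z
    exact (hV (A z)).comp_analyticAt (hAa z)
  refine ⟨β, ?_, ?_⟩
  · intro hκ
    have : α = 0 := by simp [hα, hκ]
    rw [hβ, this]; simpa using hw₀
  · have e1 := eventually_eq_of_frequently hu hUm (x := z₀) (by
      refine Eventually.frequently ?_
      filter_upwards [nhdsWithin_le_nhds hzero] with z hz
      simpa [sub_eq_zero] using hz)
    have e2 := eventually_eq_of_frequently hv hVm (x := z₀) (by
      refine Eventually.frequently ?_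
      filter_upwards [nhdsWithin_le_nhds hzero, nhdsWithin_le_nhds hkey] with z hz hk
      simp only [Pi.sub_apply] at hz
      rw [hz, mul_zero, sub_eq_zero] at hk
      exact hk)
    filter_upwards [e1, e2] with z h1 h2
    exact ⟨h1, h2⟩

/-! ### Uniformizations of complex elliptic curves -/

lemma lattice_countable (τ : ℍ) : (lattice τ : Set ℂ).Countable := by
  simpa using countable_not_of_eventually_codiscrete (eventually_notMem_lattice τ)

lemma mem_lattice_real_iff {τ : ℍ} {x : ℝ} : (x : ℂ) ∈ lattice τ ↔ ∃ m : ℤ, (m : ℝ) = x := by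
  rw [mem_lattice_iff]
  constructor
  · rintro ⟨m, n, h⟩
    have h1 := congrArg Complex.im h
    have h2 := congrArg Complex.re h
    simp [τ.im_ne_zero] at h1
    subst h1
    exact ⟨m, by simpa using h2⟩
  · rintro ⟨m, rfl⟩
    exact ⟨m, 0, by simp⟩

lemma quarter_notMem {τ : ℍ} : ((1 / 4 : ℝ) : ℂ) ∉ lattice τ := by
  rw [mem_lattice_real_iff]
  rintro ⟨m, hm⟩
  have : ((4 * m : ℤ) : ℝ) = ((1 : ℤ) : ℝ) := by push_cast; linarith
  have := Int.cast_injective this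
  omega

lemma half_notMem {τ : ℍ} : ((1 / 2 : ℝ) : ℂ) ∉ lattice τ := by
  rw [mem_lattice_real_iff]
  rintro ⟨m, hm⟩
  have : ((2 * m : ℤ) : ℝ) = ((1 : ℤ) : ℝ) := by push_cast; linarith
  have := Int.cast_injective this
  omega

/-- Meromorphic coordinate functions of an analytic isomorphism `ℂ / (ℤ + τℤ) ≃ E(ℂ)`. -/
structure Uniformization (E : WeierstrassCurve ℂ) (τ : ℍ) (X Y : ℂ → ℂ) : Prop where
  meromorphicX : Meromorphic X
  meromorphicY : Meromorphic Y
  analyticX : ∀ z, z ∉ lattice τ → AnalyticAt ℂ X z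
  analyticY : ∀ z, z ∉ lattice τ → AnalyticAt ℂ Y z
  equation : ∀ z, z ∉ lattice τ → E.toAffine.Equation (X z) (Y z)
  add_period : ∀ z, z ∉ lattice τ → ∀ l ∈ lattice τ, X (z + l) = X z ∧ Y (z + l) = Y z
  inj : ∀ z, z ∉ lattice τ → ∀ w, w ∉ lattice τ → X z = X w → Y z = Y w → z - w ∈ lattice τ
  surj : ∀ x y, E.toAffine.Equation x y → ∃ z, z ∉ lattice τ ∧ X z = x ∧ Y z = y
  even : ∀ z, z ∉ lattice τ → X (-z) = X z

lemma exists_uniformization {E : WeierstrassCurve ℂ} [E.IsElliptic] {τ : ℍ}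
    (h : IsUniformizedBy E τ) : ∃ X Y, Uniformization E τ X Y := by
  classical
  obtain ⟨e, X, Y, hX, hY, h⟩ := h
  let q : ℂ → E.toAffine.Point := fun z => e (QuotientAddGroup.mk z)
  have hq : ∀ z w, q z = q w ↔ z - w ∈ lattice τ := by
    intro z w
    simp only [q, EmbeddingLike.apply_eq_iff_eq]
    rw [QuotientAddGroup.eq, ← neg_mem_iff]
    simp [sub_eq_add_neg, add_comm]
  have hqadd : ∀ z w, q (z + w) = q z + q w := fun z w => by
    simp only [q, QuotientAddGroup.mk_add, map_add]
  have hqneg : ∀ z, q (-z) = -q z := fun z => by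
    simp only [q, QuotientAddGroup.mk_neg, map_neg]
  have hq0 : ∀ z ∈ lattice τ, q z = 0 := by
    intro z hz
    have h1 := (hq z 0).2 (by simpa using hz)
    rw [h1]
    change e ((0 : ℂ) : ℂ ⧸ lattice τ) = 0
    simp
  have hns : ∀ z, z ∉ lattice τ → E.toAffine.Nonsingular (X z) (Y z) := fun z hz => (h z hz).1
  have hqz : ∀ z (hz : z ∉ lattice τ), q z = .some (X z) (Y z) (hns z hz) := fun z hz => by
    obtain ⟨h1, h2⟩ := h z hz
    exact h2
  have hopen : IsOpen ((lattice τ : Set ℂ)ᶜ) := (isClosed_lattice τ).isOpen_compl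
  have hXa : ∀ z, z ∉ lattice τ → AnalyticAt ℂ X z := fun z hz =>
    hX.analyticAt (hopen.mem_nhds hz)
  have hYa : ∀ z, z ∉ lattice τ → AnalyticAt ℂ Y z := fun z hz =>
    hY.analyticAt (hopen.mem_nhds hz)
  have hinj : ∀ z, z ∉ lattice τ → ∀ w, w ∉ lattice τ → X z = X w → Y z = Y w →
      z - w ∈ lattice τ := by
    intro z hz w hw h1 h2
    rw [← hq, hqz z hz, hqz w hw]
    simp [h1, h2]
  have hXeq : ∀ z, z ∉ lattice τ → ∀ w, w ∉ lattice τ → X z = X w →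
      z - w ∈ lattice τ ∨ z + w ∈ lattice τ := by
    intro z hz w hw h1
    have h2 := (WeierstrassCurve.Affine.Point.X_eq_iff (h₁ := hns z hz) (h₂ := hns w hw)).1 h1
    rw [← hqz z hz, ← hqz w hw, ← hqneg, hq, hq, sub_neg_eq_add] at h2
    exact h2
  have heven : ∀ z, z ∉ lattice τ → X (-z) = X z := by
    intro z hz
    have hz' : -z ∉ lattice τ := by rwa [neg_mem_iff]
    refine (WeierstrassCurve.Affine.Point.X_eq_iff (h₁ := hns _ hz') (h₂ := hns z hz)).2 (.inr ?_)
    rw [← hqz _ hz, ← hqz _ hz', hqneg]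
  -- meromorphy at the lattice points comes from the addition formula
  have hmer : ∀ l ∈ lattice τ, MeromorphicAt X l ∧ MeromorphicAt Y l := by
    intro l hl
    -- The decomposition z = (z + w) + (-w) needs w and 2w outside the lattice: then near l the two
    -- summands avoid the lattice and have distinct x-coordinates. The value 1/4 works for every τ.
    set w : ℂ := ((1 / 4 : ℝ) : ℂ) with hw
    have hwL : w ∉ lattice τ := quarter_notMem
    have hwL' : -w ∉ lattice τ := by rwa [neg_mem_iff]
    have h2w : w + w ∉ lattice τ := by
      have := half_notMem (τ := τ)
      convert this using 1
      rw [hw]; push_cast; norm_num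
    have hlw : l + w ∉ lattice τ := fun hc => hwL ((add_mem_cancel_left hl).1 hc)
    have hlw2 : l + (w + w) ∉ lattice τ := fun hc => h2w ((add_mem_cancel_left hl).1 hc)
    have haX : AnalyticAt ℂ (fun z => X (z + w)) l :=
      AnalyticAt.comp_of_eq (hXa _ hlw) (by fun_prop) rfl
    have haY : AnalyticAt ℂ (fun z => Y (z + w)) l :=
      AnalyticAt.comp_of_eq (hYa _ hlw) (by fun_prop) rfl
    set S : ℂ → ℂ := fun z => (Y (z + w) - Y (-w)) / (X (z + w) - X (-w)) with hS
    have hSm : MeromorphicAt S l :=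
      (haY.sub analyticAt_const).meromorphicAt.fun_div (haX.sub analyticAt_const).meromorphicAt
    have hmX := haX.meromorphicAt
    have hmY := haY.meromorphicAt
    have hform : ∀ᶠ z in 𝓝[≠] l, X z = E.toAffine.addX (X (z + w)) (X (-w)) (S z) ∧
        Y z = E.toAffine.addY (X (z + w)) (X (-w)) (Y (z + w)) (S z) := by
      have t1 : ∀ᶠ z in 𝓝[≠] l, z + w ∉ lattice τ := by
        have : Tendsto (fun z => z + w) (𝓝[≠] l) (𝓝 (l + w)) :=
          ((continuous_id.add continuous_const).tendsto l).mono_left nhdsWithin_le_nhds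
        exact this.eventually (eventually_nhds_notMem_lattice hlw)
      have t2 : ∀ᶠ z in 𝓝[≠] l, z + (w + w) ∉ lattice τ := by
        have : Tendsto (fun z => z + (w + w)) (𝓝[≠] l) (𝓝 (l + (w + w))) :=
          ((continuous_id.add continuous_const).tendsto l).mono_left nhdsWithin_le_nhds
        exact this.eventually (eventually_nhds_notMem_lattice hlw2)
      filter_upwards [t1, t2, eventually_codiscrete_iff.1 (eventually_notMem_lattice τ) l]
        with z h1 h2 h3
      have hne : X (z + w) ≠ X (-w) := by
        intro hc
        rcases hXeq _ h1 _ hwL' hc with h4 | h4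
        · exact h2 (by simpa [add_assoc] using h4)
        · exact h3 (by simpa using h4)
      have h5 : q z = q (z + w) + q (-w) := by rw [← hqadd]; simp
      rw [hqz z h3, hqz _ h1, hqz _ hwL', WeierstrassCurve.Affine.Point.add_of_X_ne hne] at h5
      simp only [WeierstrassCurve.Affine.Point.some.injEq] at h5
      rw [WeierstrassCurve.Affine.slope_of_X_ne hne] at h5
      exact h5
    constructor
    · refine MeromorphicAt.congr (f := fun z => E.toAffine.addX (X (z + w)) (X (-w)) (S z)) ?_ ?_
      · simp only [WeierstrassCurve.Affine.addX]
        fun_prop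
      · filter_upwards [hform] with z hz using hz.1.symm
    · refine MeromorphicAt.congr
        (f := fun z => E.toAffine.addY (X (z + w)) (X (-w)) (Y (z + w)) (S z)) ?_ ?_
      · simp only [WeierstrassCurve.Affine.addX, WeierstrassCurve.Affine.addY,
          WeierstrassCurve.Affine.negY, WeierstrassCurve.Affine.negAddY]
        fun_prop
      · filter_upwards [hform] with z hz using hz.2.symm
  refine ⟨X, Y, ⟨fun z => ?_, fun z => ?_, hXa, hYa, fun z hz => (hns z hz).1, ?_, hinj, ?_, heven⟩⟩
  · by_cases hz : z ∈ lattice τ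
    · exact (hmer z hz).1
    · exact (hXa z hz).meromorphicAt
  · by_cases hz : z ∈ lattice τ
    · exact (hmer z hz).2
    · exact (hYa z hz).meromorphicAt
  · intro z hz l hl
    have hzl : z + l ∉ lattice τ := fun hc => hz ((add_mem_cancel_right hl).1 hc)
    have h1 : q (z + l) = q z := by rw [hq]; simpa using hl
    rw [hqz _ hz, hqz _ hzl] at h1
    simpa using h1
  · intro x y hxy
    have hxy' : E.toAffine.Nonsingular x y := E.toAffine.equation_iff_nonsingular.1 hxy
    obtain ⟨t, ht⟩ := e.surjective (.some x y hxy')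
    obtain ⟨z, rfl⟩ := QuotientAddGroup.mk_surjective t
    have hz : z ∉ lattice τ := by
      intro hc
      have := hq0 z hc
      change q z = _ at ht
      rw [this] at ht
      exact WeierstrassCurve.Affine.Point.some_ne_zero hxy' ht.symm
    refine ⟨z, hz, ?_⟩
    change q z = _ at ht
    rw [hqz z hz] at ht
    simpa using ht

/-! ### Short Weierstrass coordinates -/

/-- The invariant `g₂` of the model `v² = 4u³ - g₂u - g₃`. -/
noncomputable def shortG₂ (E : WeierstrassCurve ℂ) : ℂ := E.c₄ / 12

/-- The invariant `g₃` of the model `v² = 4u³ - g₂u - g₃`. -/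
noncomputable def shortG₃ (E : WeierstrassCurve ℂ) : ℂ := E.c₆ / 216

/-- The coordinate `u` of the model `v² = 4u³ - g₂u - g₃`. -/
noncomputable def shortX (E : WeierstrassCurve ℂ) (x : ℂ) : ℂ := x + E.b₂ / 12

/-- The coordinate `v` of the model `v² = 4u³ - g₂u - g₃`. -/
noncomputable def shortY (E : WeierstrassCurve ℂ) (x y : ℂ) : ℂ := 2 * y + E.a₁ * x + E.a₃

lemma short_discr (E : WeierstrassCurve ℂ) : shortG₂ E ^ 3 - 27 * shortG₃ E ^ 2 = E.Δ := by
  have := E.c_relation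
  simp only [shortG₂, shortG₃]
  linear_combination -this / 1728

lemma short_discr_ne_zero (E : WeierstrassCurve ℂ) [E.IsElliptic] :
    shortG₂ E ^ 3 - 27 * shortG₃ E ^ 2 ≠ 0 := by
  rw [short_discr]
  exact E.isUnit_Δ.ne_zero

lemma equation_iff_short (E : WeierstrassCurve ℂ) (x y : ℂ) : E.toAffine.Equation x y ↔
    shortY E x y ^ 2 = 4 * shortX E x ^ 3 - shortG₂ E * shortX E x - shortG₃ E := by
  rw [WeierstrassCurve.Affine.equation_iff]
  simp only [shortX, shortY, shortG₂, shortG₃, WeierstrassCurve.c₄, WeierstrassCurve.c₆,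
    WeierstrassCurve.b₂, WeierstrassCurve.b₄, WeierstrassCurve.b₆]
  constructor
  · intro h; linear_combination 4 * h
  · intro h; linear_combination h / 4

lemma short_inj (E : WeierstrassCurve ℂ) {x y x' y' : ℂ} (h : shortX E x = shortX E x')
    (h' : shortY E x y = shortY E x' y') : x = x' ∧ y = y' := by
  simp only [shortX, shortY] at h h'
  have : x = x' := by linear_combination h
  subst this
  exact ⟨rfl, by linear_combination h' / 2⟩

namespace Uniformization

variable {E : WeierstrassCurve ℂ} {τ : ℍ} {X Y : ℂ → ℂ}

lemma surj_short (h : Uniformization E τ X Y) (u v : ℂ)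
    (huv : v ^ 2 = 4 * u ^ 3 - shortG₂ E * u - shortG₃ E) :
    ∃ z ∈ (lattice τ : Set ℂ)ᶜ, shortX E (X z) = u ∧ shortY E (X z) (Y z) = v := by
  obtain ⟨z, hz, h1, h2⟩ := h.surj (u - E.b₂ / 12) ((v - E.a₁ * (u - E.b₂ / 12) - E.a₃) / 2) (by
    rw [equation_iff_short]
    simp only [shortX, shortY]
    ring_nf
    ring_nf at huv
    exact huv)
  refine ⟨z, hz, ?_, ?_⟩
  · rw [h1]; simp [shortX]
  · rw [h1, h2]; simp only [shortY]; ring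

lemma exists_shortX_eq (h : Uniformization E τ X Y) (u : ℂ) :
    ∃ z ∈ (lattice τ : Set ℂ)ᶜ, shortX E (X z) = u := by
  obtain ⟨v, hv⟩ := IsAlgClosed.exists_pow_nat_eq (4 * u ^ 3 - shortG₂ E * u - shortG₃ E) two_pos
  obtain ⟨z, hz, h1, -⟩ := h.surj_short u v hv
  exact ⟨z, hz, h1⟩

lemma short_eq (h : Uniformization E τ X Y) (z : ℂ) (hz : z ∉ lattice τ) :
    shortY E (X z) (Y z) ^ 2 =
      4 * shortX E (X z) ^ 3 - shortG₂ E * shortX E (X z) - shortG₃ E :=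
  (equation_iff_short E _ _).1 (h.equation z hz)

lemma meromorphic_shortX (h : Uniformization E τ X Y) : Meromorphic fun z => shortX E (X z) := by
  have := h.meromorphicX
  simp only [shortX]
  fun_prop

lemma meromorphic_shortY (h : Uniformization E τ X Y) :
    Meromorphic fun z => shortY E (X z) (Y z) := by
  have := h.meromorphicX
  have := h.meromorphicY
  simp only [shortY]
  fun_prop

lemma analyticAt_shortX (h : Uniformization E τ X Y) (z : ℂ) (hz : z ∉ lattice τ) :
    AnalyticAt ℂ (fun z => shortX E (X z)) z := by
  have := h.analyticX z hz
  simp only [shortX]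
  fun_prop

lemma analyticAt_shortY (h : Uniformization E τ X Y) (z : ℂ) (hz : z ∉ lattice τ) :
    AnalyticAt ℂ (fun z => shortY E (X z) (Y z)) z := by
  have := h.analyticX z hz
  have := h.analyticY z hz
  simp only [shortY]
  fun_prop

lemma shortY_ne_zero (h : Uniformization E τ X Y) :
    ∀ᶠ z in codiscrete ℂ, shortY E (X z) (Y z) ≠ 0 := by
  refine (eventually_eq_zero_or_ne_zero h.meromorphic_shortY).resolve_left fun h0 => ?_
  -- The second difference of the cubic over 0, 1, 2 equals 24, so it cannot vanish at all three.
  obtain ⟨u, hu⟩ : ∃ u, 4 * u ^ 3 - shortG₂ E * u - shortG₃ E ≠ 0 := by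
    by_contra! hc
    have h1 := hc 0
    have h2 := hc 1
    have h3 := hc 2
    have : (24 : ℂ) = 0 := by linear_combination h3 - 2 * h2 + h1
    norm_num at this
  obtain ⟨v, hv⟩ := IsAlgClosed.exists_pow_nat_eq (4 * u ^ 3 - shortG₂ E * u - shortG₃ E) two_pos
  obtain ⟨z, hz, h1, h2⟩ := h.surj_short u v hv
  have h3 : shortY E (X z) (Y z) = 0 :=
    eq_of_eventually_codiscrete (f := fun z => shortY E (X z) (Y z)) (g := fun _ => 0)
      (h.analyticAt_shortY z hz).continuousAt continuousAt_const h0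
  rw [h2] at h3
  rw [h3] at hv
  exact hu (by rw [← hv]; simp)

/-- The constant is nonzero because otherwise the u-coordinate would be constant on the connected
complement of the lattice, although it takes every value. -/
lemma exists_deriv_eq [E.IsElliptic] (h : Uniformization E τ X Y) :
    ∃ c ≠ 0, ∀ z, z ∉ lattice τ →
      deriv (fun z => shortX E (X z)) z = c * shortY E (X z) (Y z) := by
  obtain ⟨c, hc⟩ := exists_const_deriv_eq_mul (short_discr_ne_zero E) τ h.meromorphic_shortX
    h.meromorphic_shortY
    (by filter_upwards [eventually_notMem_lattice τ] with z hz using h.short_eq z hz)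
    h.shortY_ne_zero
    (fun l hl => by
      filter_upwards [eventually_notMem_lattice τ] with z hz
      rw [(h.add_period z hz l hl).1])
    (fun l hl => by
      filter_upwards [eventually_notMem_lattice τ] with z hz
      rw [(h.add_period z hz l hl).1, (h.add_period z hz l hl).2])
  have hc' : ∀ z, z ∉ lattice τ →
      deriv (fun z => shortX E (X z)) z = c * shortY E (X z) (Y z) := fun z hz =>
    eq_of_eventually_codiscrete (g := fun z => c * shortY E (X z) (Y z))
      (h.analyticAt_shortX z hz).deriv.continuousAt
      (continuousAt_const.mul (h.analyticAt_shortY z hz).continuousAt) hc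
  refine ⟨c, ?_, hc'⟩
  rintro rfl
  have hconn : IsPreconnected ((lattice τ : Set ℂ)ᶜ) :=
    (((lattice_countable τ).isPathConnected_compl_of_one_lt_rank (by
      rw [Complex.rank_real_complex]; norm_num)).isConnected).isPreconnected
  obtain ⟨z₀, hz₀, h0⟩ := h.exists_shortX_eq 0
  obtain ⟨z₁, hz₁, h1⟩ := h.exists_shortX_eq 1
  have := (isClosed_lattice τ).isOpen_compl.is_const_of_deriv_eq_zero hconn
    (f := fun z => shortX E (X z))
    (fun z hz => (h.analyticAt_shortX z hz).differentiableAt.differentiableWithinAt)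
    (fun z hz => by simpa using hc' z hz) hz₀ hz₁
  rw [h0, h1] at this
  exact zero_ne_one this

end Uniformization

/-! ### Evaluation of functions at generic points -/

section FunctionField

open WeierstrassCurve.Affine

variable {F : Type*} [Field F]

/-- The coordinate function `y` in the function field of a Weierstrass curve. -/
noncomputable def yFunction (W : WeierstrassCurve F) : W.toAffine.FunctionField :=
  algebraMap W.toAffine.CoordinateRing W.toAffine.FunctionField
    (CoordinateRing.mk W.toAffine Polynomial.X)

lemma functionField_ringHom_ext {W : WeierstrassCurve F} {R : Type*} [Field R]
    {f g : W.toAffine.FunctionField →+* R}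
    (h : ∀ a : F, f (algebraMap F _ a) = g (algebraMap F _ a))
    (hx : f (xFunction W) = g (xFunction W)) (hy : f (yFunction W) = g (yFunction W)) : f = g := by
  refine IsFractionRing.ringHom_ext (A := W.toAffine.CoordinateRing) fun a => ?_
  have h1 : (f.comp (algebraMap W.toAffine.CoordinateRing W.toAffine.FunctionField)).comp
      (CoordinateRing.mk W.toAffine) =
      (g.comp (algebraMap W.toAffine.CoordinateRing W.toAffine.FunctionField)).comp
      (CoordinateRing.mk W.toAffine) := by
    refine Polynomial.ringHom_ext' (Polynomial.ringHom_ext (fun a => ?_) hx) hy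
    have := h a
    rw [IsScalarTower.algebraMap_apply F W.toAffine.CoordinateRing W.toAffine.FunctionField] at this
    exact this
  obtain ⟨p, rfl⟩ := AdjoinRoot.mk_surjective a
  exact RingHom.congr_fun h1 p

lemma transcendental_xFunction (W : WeierstrassCurve F) : Transcendental F (xFunction W) := by
  have h1 : Transcendental F (Polynomial.X : F[X]) := Polynomial.transcendental_X F
  have hinj : Function.Injective (algebraMap F[X] W.toAffine.FunctionField) :=
    FaithfulSMul.algebraMap_injective _ _
  have h2 := (transcendental_algebraMap_iff (R := F) hinj (a := Polynomial.X)).2 h1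
  rw [IsScalarTower.algebraMap_apply F[X] W.toAffine.CoordinateRing W.toAffine.FunctionField] at h2
  exact h2

lemma equation_functions (W : WeierstrassCurve F) :
    yFunction W ^ 2 + algebraMap F _ W.a₁ * xFunction W * yFunction W
      + algebraMap F _ W.a₃ * yFunction W =
    xFunction W ^ 3 + algebraMap F _ W.a₂ * xFunction W ^ 2 + algebraMap F _ W.a₄ * xFunction W
      + algebraMap F _ W.a₆ := by
  have h : CoordinateRing.mk W.toAffine (Polynomial.X ^ 2 +
      Polynomial.C (Polynomial.C W.a₁ * Polynomial.X + Polynomial.C W.a₃) * Polynomial.X -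
      Polynomial.C (Polynomial.X ^ 3 + Polynomial.C W.a₂ * Polynomial.X ^ 2 +
        Polynomial.C W.a₄ * Polynomial.X + Polynomial.C W.a₆)) = 0 := AdjoinRoot.mk_self
  have h2 := congrArg (algebraMap W.toAffine.CoordinateRing W.toAffine.FunctionField) h
  rw [map_zero] at h2
  have hc : ∀ a : F, algebraMap F W.toAffine.FunctionField a =
      algebraMap W.toAffine.CoordinateRing W.toAffine.FunctionField
        (CoordinateRing.mk W.toAffine (Polynomial.C (Polynomial.C a))) := fun a => by
    rw [IsScalarTower.algebraMap_apply F W.toAffine.CoordinateRing W.toAffine.FunctionField]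
    rfl
  rw [hc, hc, hc, hc, hc, xFunction, yFunction, ← sub_eq_zero, ← h2]
  simp only [map_add, map_sub, map_mul, map_pow]
  ring

/-- 1 and y form a basis of the coordinate ring over F[X], and the coefficient of y is 2. -/
lemma shortY_function_ne_zero [CharZero F] (W : WeierstrassCurve F) :
    2 * yFunction W + algebraMap F _ W.a₁ * xFunction W + algebraMap F _ W.a₃ ≠ 0 := by
  intro h
  have h1 : algebraMap W.toAffine.CoordinateRing W.toAffine.FunctionField
      ((Polynomial.C W.a₁ * Polynomial.X + Polynomial.C W.a₃) • (1 : W.toAffine.CoordinateRing) +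
        (2 : F[X]) • CoordinateRing.mk W.toAffine Polynomial.X) = 0 := by
    rw [← h, CoordinateRing.smul, CoordinateRing.smul, xFunction, yFunction,
      IsScalarTower.algebraMap_apply F W.toAffine.CoordinateRing W.toAffine.FunctionField,
      IsScalarTower.algebraMap_apply F W.toAffine.CoordinateRing W.toAffine.FunctionField]
    have hc : ∀ a : F, algebraMap F W.toAffine.CoordinateRing a =
        CoordinateRing.mk W.toAffine (Polynomial.C (Polynomial.C a)) := fun a => rfl
    rw [hc, hc]
    simp only [map_add, map_mul, mul_one, map_ofNat]
    ring
  have h2 := (IsFractionRing.injective W.toAffine.CoordinateRing W.toAffine.FunctionField)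
    (h1.trans (map_zero _).symm)
  have h3 := (CoordinateRing.smul_basis_eq_zero h2).2
  exact two_ne_zero h3

/-- A point with coordinates in an extension field which is not algebraic. -/
structure IsGenericPoint {L : Type*} [Field L] (s : F →+* L) (W : WeierstrassCurve F) (x y : L) :
    Prop where
  equation : (W.map s).toAffine.Equation x y
  notMem_range : x ∉ s.range

variable {L : Type*} [Field L] {s : F →+* L} {W : WeierstrassCurve F} {x y : L}

/-- Evaluation of regular functions at a point. -/
noncomputable def evalCoordinateRing (h : (W.map s).toAffine.Equation x y) :
    W.toAffine.CoordinateRing →+* L :=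
  AdjoinRoot.lift (Polynomial.eval₂RingHom s x) y (by
    rw [equation_iff'] at h
    rw [← h, WeierstrassCurve.Affine.polynomial]
    simp only [Polynomial.eval₂_add, Polynomial.eval₂_mul, Polynomial.eval₂_sub,
      Polynomial.eval₂_pow, Polynomial.eval₂_X, Polynomial.eval₂_C, Polynomial.coe_eval₂RingHom,
      WeierstrassCurve.map_a₁, WeierstrassCurve.map_a₂, WeierstrassCurve.map_a₃,
      WeierstrassCurve.map_a₄, WeierstrassCurve.map_a₆, WeierstrassCurve.toAffine]
    ring)

lemma evalCoordinateRing_mk (h : (W.map s).toAffine.Equation x y) (p : F[X][X]) :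
    evalCoordinateRing h (CoordinateRing.mk W.toAffine p) =
      p.eval₂ (Polynomial.eval₂RingHom s x) y :=
  AdjoinRoot.lift_mk _ _

lemma evalCoordinateRing_smul_basis (h : (W.map s).toAffine.Equation x y) (p q : F[X]) :
    evalCoordinateRing h (p • (1 : W.toAffine.CoordinateRing) +
      q • CoordinateRing.mk W.toAffine Polynomial.X) = p.eval₂ s x + q.eval₂ s x * y := by
  rw [CoordinateRing.smul, CoordinateRing.smul, mul_one, ← map_mul, ← map_add,
    evalCoordinateRing_mk]
  simp

lemma mem_range_of_eval₂_eq_zero [IsAlgClosed F] {p : F[X]} (hp : p ≠ 0)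
    (h : p.eval₂ s x = 0) : x ∈ s.range := by
  let := s.toAlgebra
  have hx : IsAlgebraic F x := ⟨p, hp, h⟩
  exact minpoly.mem_range_of_degree_eq_one F x
    (IsAlgClosed.degree_eq_one_of_irreducible F (minpoly.irreducible hx.isIntegral))

/-- The norm of b to F[X] is a multiple of b. If b vanished at the point, x would be a root of this
nonzero polynomial, hence the image of an element of the algebraically closed field F. -/
lemma evalCoordinateRing_injective [IsAlgClosed F] (h : IsGenericPoint s W x y) :
    Function.Injective (evalCoordinateRing h.equation) := by
  rw [injective_iff_map_eq_zero]
  intro b hb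
  by_contra hb0
  obtain ⟨p, q, rfl⟩ := CoordinateRing.exists_smul_basis_eq b
  have h1 := congrArg (evalCoordinateRing h.equation) (CoordinateRing.coe_norm_smul_basis (W' := W.toAffine) p q)
  have h2 : evalCoordinateRing h.equation (CoordinateRing.mk W.toAffine
      (Polynomial.C p + Polynomial.C q * Polynomial.X)) = 0 := by
    rw [← hb, evalCoordinateRing_smul_basis, evalCoordinateRing_mk]
    simp
  rw [map_mul (CoordinateRing.mk W.toAffine), map_mul, h2, zero_mul] at h1
  change evalCoordinateRing h.equation (CoordinateRing.mk W.toAffine (Polynomial.C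
    (Algebra.norm F[X] (p • (1 : W.toAffine.CoordinateRing) +
      q • CoordinateRing.mk W.toAffine Polynomial.X)))) = 0 at h1
  rw [evalCoordinateRing_mk] at h1
  simp only [Polynomial.eval₂_C, Polynomial.coe_eval₂RingHom] at h1
  refine h.notMem_range (mem_range_of_eval₂_eq_zero ?_ h1)
  have : Module.Finite F[X] W.toAffine.CoordinateRing :=
    Module.Finite.of_basis (CoordinateRing.basis W.toAffine)
  rwa [Ne, Algebra.norm_eq_zero_iff]

/-- Evaluation of rational functions at a generic point. -/
noncomputable def evalFunctionField [IsAlgClosed F] (h : IsGenericPoint s W x y) :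
    W.toAffine.FunctionField →+* L :=
  IsFractionRing.lift (evalCoordinateRing_injective h)

lemma evalFunctionField_algebraMap [IsAlgClosed F] (h : IsGenericPoint s W x y)
    (a : W.toAffine.CoordinateRing) :
    evalFunctionField h (algebraMap _ _ a) = evalCoordinateRing h.equation a :=
  IsFractionRing.lift_algebraMap _ _

lemma evalFunctionField_const [IsAlgClosed F] (h : IsGenericPoint s W x y) (a : F) :
    evalFunctionField h (algebraMap F _ a) = s a := by
  rw [IsScalarTower.algebraMap_apply F W.toAffine.CoordinateRing W.toAffine.FunctionField,
    evalFunctionField_algebraMap,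
    show algebraMap F W.toAffine.CoordinateRing a =
        CoordinateRing.mk W.toAffine (Polynomial.C (Polynomial.C a)) from rfl,
    evalCoordinateRing_mk]
  simp

lemma evalFunctionField_xFunction [IsAlgClosed F] (h : IsGenericPoint s W x y) :
    evalFunctionField h (xFunction W) = x := by
  rw [xFunction, evalFunctionField_algebraMap, evalCoordinateRing_mk]
  simp

lemma evalFunctionField_yFunction [IsAlgClosed F] (h : IsGenericPoint s W x y) :
    evalFunctionField h (yFunction W) = y := by
  rw [yFunction, evalFunctionField_algebraMap, evalCoordinateRing_mk]
  simp

end FunctionField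

/-! ### Finiteness of the degree of an isogeny -/

section Degree

open WeierstrassCurve.Affine

variable {F : Type*} [Field F]

lemma trdeg_functionField (W : WeierstrassCurve F) :
    Algebra.trdeg F W.toAffine.FunctionField = 1 := by
  have : Algebra.IsAlgebraic F[X] W.toAffine.CoordinateRing := by
    have : Module.Finite F[X] W.toAffine.CoordinateRing :=
      Module.Finite.of_basis (CoordinateRing.basis W.toAffine)
    infer_instance
  have : Algebra.IsAlgebraic W.toAffine.CoordinateRing W.toAffine.FunctionField :=
    IsLocalization.isAlgebraic _ (nonZeroDivisors W.toAffine.CoordinateRing)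
  have : Algebra.IsAlgebraic F[X] W.toAffine.FunctionField :=
    Algebra.IsAlgebraic.trans F[X] W.toAffine.CoordinateRing W.toAffine.FunctionField
  have h := _root_.trdeg_add_eq F F[X] (A := W.toAffine.FunctionField)
  rw [← h, trdeg_eq_zero (R := F[X]), add_zero, Polynomial.trdeg_of_isDomain]

lemma adjoin_functions_eq_top (W : WeierstrassCurve F) (M : IntermediateField F W.toAffine.FunctionField) :
    IntermediateField.adjoin M {xFunction W, yFunction W} = ⊤ := by
  rw [eq_top_iff]
  intro f _
  set N := IntermediateField.adjoin M {xFunction W, yFunction W}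
  have hx : xFunction W ∈ N := IntermediateField.subset_adjoin _ _ (by simp)
  have hy : yFunction W ∈ N := IntermediateField.subset_adjoin _ _ (by simp)
  have hF : ∀ a : F, algebraMap F W.toAffine.FunctionField a ∈ N := fun a => by
    have := N.algebraMap_mem (algebraMap F M a)
    exact this
  have hcoord : ∀ a : W.toAffine.CoordinateRing, algebraMap _ W.toAffine.FunctionField a ∈ N := by
    intro a
    obtain ⟨p, rfl⟩ := AdjoinRoot.mk_surjective a
    have hC : ∀ q : F[X], algebraMap _ W.toAffine.FunctionField
        (CoordinateRing.mk W.toAffine (Polynomial.C q)) ∈ N := by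
      intro q
      induction q using Polynomial.induction_on' with
      | add p q hp hq => rw [map_add, map_add, map_add]; exact N.add_mem hp hq
      | monomial n a =>
        rw [← Polynomial.C_mul_X_pow_eq_monomial, map_mul, map_mul, map_mul, map_pow, map_pow,
          map_pow]
        refine N.mul_mem ?_ (N.pow_mem hx n)
        have := hF a
        rw [IsScalarTower.algebraMap_apply F W.toAffine.CoordinateRing W.toAffine.FunctionField]
          at this
        exact this
    induction p using Polynomial.induction_on' with
    | add p q hp hq => rw [map_add, map_add]; exact N.add_mem hp hq
    | monomial n a =>
      rw [← Polynomial.C_mul_X_pow_eq_monomial, map_mul, map_mul, map_pow, map_pow]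
      exact N.mul_mem (hC a) (N.pow_mem hy n)
  obtain ⟨a, b, -, rfl⟩ := IsFractionRing.div_surjective (A := W.toAffine.CoordinateRing) f
  exact N.div_mem (hcoord a) (hcoord b)

/-- The pullback of x is transcendental and the transcendence degree is 1, so the extension is
algebraic; it is generated by x and y, hence finite. Without finiteness `finrank` would default to 0
and the degree could not bound anything. -/
lemma finiteDimensional_of_isogeny {W₁ W₂ : WeierstrassCurve F} (φ : Isogeny W₁ W₂) :
    FiniteDimensional φ.pullback.fieldRange W₁.toAffine.FunctionField := by
  set t := φ.pullback (xFunction W₂) with ht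
  have htr : Transcendental F t :=
    fun hc => transcendental_xFunction W₂
      ((isAlgebraic_algHom_iff φ.pullback φ.pullback.injective).1 hc)
  have hind : AlgebraicIndependent F ![t] := by
    rw [algebraicIndependent_unique_type_iff]
    simpa using htr
  have hbasis : IsTranscendenceBasis F ![t] :=
    hind.isTranscendenceBasis_of_lift_trdeg_le_of_finite (by
      rw [trdeg_functionField]; simp)
  have halg := hbasis.isAlgebraic
  have hle : Algebra.adjoin F (Set.range ![t]) ≤ φ.pullback.fieldRange.toSubalgebra := by
    rw [Algebra.adjoin_le_iff]
    rintro _ ⟨i, rfl⟩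
    simp [ht]
  have halg' : Algebra.IsAlgebraic φ.pullback.fieldRange W₁.toAffine.FunctionField := by
    constructor
    intro f
    obtain ⟨p, hp0, hp⟩ := halg.isAlgebraic f
    refine ⟨p.map (Subalgebra.inclusion hle).toRingHom, ?_, ?_⟩
    · rw [Ne, Polynomial.map_eq_zero_iff]
      · exact hp0
      · exact Subalgebra.inclusion_injective hle
    · rw [Polynomial.aeval_def, Polynomial.eval₂_map]
      exact hp
  have hfin : FiniteDimensional φ.pullback.fieldRange
      (IntermediateField.adjoin φ.pullback.fieldRange {xFunction W₁, yFunction W₁}) :=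
    IntermediateField.finiteDimensional_adjoin fun f _ => (halg'.isAlgebraic f).isIntegral
  rw [adjoin_functions_eq_top] at hfin
  exact Module.Finite.equiv (IntermediateField.topEquiv (F := φ.pullback.fieldRange)
    (E := W₁.toAffine.FunctionField)).toLinearEquiv

/-- Field embeddings of the function field which agree on the pullbacks of functions: there are
at most as many as the degree of the isogeny. -/
lemma card_le_degree {W₁ W₂ : WeierstrassCurve F} (φ : Isogeny W₁ W₂) {L : Type*} [Field L]
    {ι : Type*} [Fintype ι] (f : ι → W₁.toAffine.FunctionField →+* L) (hf : Function.Injective f)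
    (h : ∀ i j g, f i (φ.pullback g) = f j (φ.pullback g)) : Fintype.card ι ≤ φ.degree := by
  have := finiteDimensional_of_isogeny φ
  rcases isEmpty_or_nonempty ι with hι | ⟨⟨i₀⟩⟩
  · simp
  let : Algebra φ.pullback.fieldRange L :=
    ((f i₀).comp (algebraMap φ.pullback.fieldRange W₁.toAffine.FunctionField)).toAlgebra
  let F' : ι → (W₁.toAffine.FunctionField →ₐ[φ.pullback.fieldRange] L) := fun i =>
    { f i with
      commutes' := by
        rintro ⟨_, g, rfl⟩
        exact h i i₀ g }
  have hF' : Function.Injective F' := by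
    intro i j hij
    apply hf
    ext g
    exact DFunLike.congr_fun hij g
  have h1 := Nat.card_le_card_of_injective F' hF'
  rw [Nat.card_eq_fintype_card] at h1
  have hfree : Module.Free φ.pullback.fieldRange W₁.toAffine.FunctionField :=
    Module.Free.of_divisionRing _ _
  exact h1.trans (card_algHom_le_finrank _ _ _)

end Degree

/-! ### The affine map lifting an isogeny -/

lemma Uniformization.ne_const {E : WeierstrassCurve ℂ} {τ : ℍ} {X Y : ℂ → ℂ}
    (h : Uniformization E τ X Y) (c : ℂ) : ∀ᶠ z in codiscrete ℂ, X z ≠ c := by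
  have hm : Meromorphic fun z => X z - c := by
    have := h.meromorphicX
    fun_prop
  rcases eventually_eq_zero_or_ne_zero hm with h0 | h0
  · exfalso
    obtain ⟨z, hz, h1⟩ := h.exists_shortX_eq (c + E.b₂ / 12 + 1)
    have h2 : X z - c = 0 := eq_of_eventually_codiscrete (f := fun z => X z - c) (g := fun _ => 0)
      ((h.analyticX z hz).continuousAt.sub continuousAt_const) continuousAt_const h0
    have : (1 : ℂ) = 0 := by
      simp only [shortX] at h1
      linear_combination h2 - h1
    exact one_ne_zero this
  · filter_upwards [h0] with z hz hc
    exact hz (by rw [hc, sub_self])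

section

variable {F : Type*} [Field F] {s : F →+* ℂ} {W W₁ W₂ : WeierstrassCurve F}
  {τ τ₁ τ₂ : ℍ} {X Y X₁ Y₁ X₂ Y₂ : ℂ → ℂ}

lemma meromorphic_eval₂ (hX : Meromorphic X) (p : F[X]) :
    Meromorphic fun z => p.eval₂ s (X z) := by
  induction p using Polynomial.induction_on' with
  | add p q hp hq =>
    simp only [Polynomial.eval₂_add]
    exact hp.fun_add hq
  | monomial n a =>
    simp only [Polynomial.eval₂_monomial]
    fun_prop

/-- For each of the countably many constants a, X takes the value s(a) only on a countable set. -/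
lemma countable_not_isGenericPoint [Countable F] (h : Uniformization (W.map s) τ X Y) :
    {z | ¬ (z ∉ lattice τ ∧ IsGenericPoint s W (X z) (Y z))}.Countable := by
  have h1 : {z | ¬ (z ∉ lattice τ ∧ IsGenericPoint s W (X z) (Y z))} ⊆
      {z | ¬ z ∉ lattice τ} ∪ ⋃ a : F, {z | ¬ X z ≠ s a} := by
    intro z hz
    by_contra hc
    simp only [Set.mem_union, Set.mem_iUnion, Set.mem_ofPred_eq, not_or, not_not, not_exists] at hc
    refine hz ⟨hc.1, h.equation z hc.1, ?_⟩
    rintro ⟨a, ha⟩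
    exact hc.2 a ha.symm
  refine Set.Countable.mono h1 ?_
  exact (countable_not_of_eventually_codiscrete (eventually_notMem_lattice τ)).union
    (Set.countable_iUnion fun a => countable_not_of_eventually_codiscrete (h.ne_const (s a)))

lemma evalFunctionField_congr [IsAlgClosed F] {x x' y y' : ℂ} (h : IsGenericPoint s W x y)
    (h' : IsGenericPoint s W x' y') (hx : x = x') (hy : y = y') :
    evalFunctionField h = evalFunctionField h' := by
  subst hx hy; rfl

lemma exists_meromorphic_eval [IsAlgClosed F] (h : Uniformization (W.map s) τ X Y)
    (f : W.toAffine.FunctionField) : ∃ Φ : ℂ → ℂ, Meromorphic Φ ∧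
      ∀ z (hz : IsGenericPoint s W (X z) (Y z)), evalFunctionField hz f = Φ z := by
  obtain ⟨a, b, -, rfl⟩ := IsFractionRing.div_surjective (A := W.toAffine.CoordinateRing) f
  obtain ⟨p, q, rfl⟩ := WeierstrassCurve.Affine.CoordinateRing.exists_smul_basis_eq a
  obtain ⟨p', q', rfl⟩ := WeierstrassCurve.Affine.CoordinateRing.exists_smul_basis_eq b
  refine ⟨fun z => (p.eval₂ s (X z) + q.eval₂ s (X z) * Y z) /
    (p'.eval₂ s (X z) + q'.eval₂ s (X z) * Y z), ?_, fun z hz => ?_⟩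
  · have hY := h.meromorphicY
    have h1 := meromorphic_eval₂ (s := s) h.meromorphicX p
    have h2 := meromorphic_eval₂ (s := s) h.meromorphicX q
    have h3 := meromorphic_eval₂ (s := s) h.meromorphicX p'
    have h4 := meromorphic_eval₂ (s := s) h.meromorphicX q'
    exact (h1.fun_add (h2.fun_mul hY)).fun_div (h3.fun_add (h4.fun_mul hY))
  · rw [map_div₀, evalFunctionField_algebraMap, evalFunctionField_algebraMap,
      evalCoordinateRing_smul_basis, evalCoordinateRing_smul_basis]

/-- The points `z` at which the isogeny is computed by the affine map `z ↦ αz + β`. -/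
def IsLiftPoint [IsAlgClosed F] (s : F →+* ℂ) (φ : Isogeny W₁ W₂) (τ₁ τ₂ : ℍ)
    (X₁ Y₁ X₂ Y₂ : ℂ → ℂ) (α β z : ℂ) : Prop :=
  z ∉ lattice τ₁ ∧ α * z + β ∉ lattice τ₂ ∧ ∃ hz : IsGenericPoint s W₁ (X₁ z) (Y₁ z),
    evalFunctionField hz (φ.pullback (xFunction W₂)) = X₂ (α * z + β) ∧
    evalFunctionField hz (φ.pullback (yFunction W₂)) = Y₂ (α * z + β)

/-- Evaluating the pulled-back coordinates along the first uniformization gives a doubly periodic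
parametrization of the second curve. Its invariant differential is constant, as is that of the
second uniformization, so the two differ by an affine map. -/
lemma exists_lift [IsAlgClosed F] [CharZero F] [Countable F] [(W₂.map s).IsElliptic]
    (h₁ : Uniformization (W₁.map s) τ₁ X₁ Y₁) (h₂ : Uniformization (W₂.map s) τ₂ X₂ Y₂)
    (φ : Isogeny W₁ W₂) :
    ∃ α β, {z | ¬ IsLiftPoint s φ τ₁ τ₂ X₁ Y₁ X₂ Y₂ α β z}.Countable := by
  obtain ⟨ξ, hξ, hξe⟩ := exists_meromorphic_eval h₁ (φ.pullback (xFunction W₂))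
  obtain ⟨η, hη, hηe⟩ := exists_meromorphic_eval h₁ (φ.pullback (yFunction W₂))
  set E := W₂.map s
  set u : ℂ → ℂ := fun z => shortX E (ξ z) with hu
  set v : ℂ → ℂ := fun z => shortY E (ξ z) (η z) with hv
  have hum : Meromorphic u := by simp only [hu, shortX]; fun_prop
  have hvm : Meromorphic v := by simp only [hv, shortY]; fun_prop
  have hG := countable_not_isGenericPoint h₁
  have huv : ∀ᶠ z in codiscrete ℂ,
      v z ^ 2 = 4 * u z ^ 3 - shortG₂ E * u z - shortG₃ E := by
    refine eventually_eq_of_countable (f := fun z => v z ^ 2)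
      (g := fun z => 4 * u z ^ 3 - shortG₂ E * u z - shortG₃ E) (by fun_prop) (by fun_prop)
      (hG.mono ?_)
    intro z hz hzG
    refine hz ((equation_iff_short E _ _).1 ?_)
    rw [WeierstrassCurve.Affine.equation_iff, ← hξe z hzG.2, ← hηe z hzG.2]
    have h := congrArg (fun f => evalFunctionField hzG.2 (φ.pullback f)) (equation_functions W₂)
    simp only [map_add, map_mul, map_pow, AlgHom.commutes, evalFunctionField_const] at h
    exact h
  have hv0 : ∀ᶠ z in codiscrete ℂ, v z ≠ 0 := by
    refine (eventually_eq_zero_or_ne_zero hvm).resolve_left fun h0 => ?_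
    obtain ⟨z, hz1, hz2⟩ := exists_of_countable_not
      (p := fun z => (z ∉ lattice τ₁ ∧ IsGenericPoint s W₁ (X₁ z) (Y₁ z)) ∧ v z = 0) (by
        refine (hG.union (countable_not_of_eventually_codiscrete h0)).mono ?_
        intro z hz
        rw [Set.mem_ofPred_eq, not_and_or] at hz
        exact hz)
    refine shortY_function_ne_zero W₂ ?_
    have : evalFunctionField hz1.2 (φ.pullback (2 * yFunction W₂ +
        algebraMap F _ W₂.a₁ * xFunction W₂ + algebraMap F _ W₂.a₃)) = 0 := by
      rw [← hz2]
      simp only [map_add, map_mul, map_ofNat, AlgHom.commutes, evalFunctionField_const, hv, shortY,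
        hξe, hηe]
      rfl
    rw [map_eq_zero, map_eq_zero] at this
    exact this
  have hper : ∀ l ∈ lattice τ₁, ∀ f (Φ : ℂ → ℂ), Meromorphic Φ →
      (∀ z (hz : IsGenericPoint s W₁ (X₁ z) (Y₁ z)), evalFunctionField hz f = Φ z) →
      ∀ᶠ z in codiscrete ℂ, Φ (z + l) = Φ z := by
    intro l hl f Φ hΦ hΦe
    refine eventually_eq_of_countable (f := fun z => Φ (z + l)) (g := Φ)
      (Meromorphic.meromorphic_fun_comp_add_const_iff_meromorphic.2 hΦ) hΦ (hG.mono ?_)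
    intro z hz hzG
    obtain ⟨hx, hy⟩ := h₁.add_period z hzG.1 l hl
    have hg : IsGenericPoint s W₁ (X₁ (z + l)) (Y₁ (z + l)) := by
      rw [hx, hy]; exact hzG.2
    refine hz ?_
    rw [← hΦe z hzG.2, ← hΦe _ hg, evalFunctionField_congr hg hzG.2 hx hy]
  obtain ⟨κ, hκ⟩ := exists_const_deriv_eq_mul (short_discr_ne_zero E) τ₁ hum hvm huv hv0
    (fun l hl => by
      filter_upwards [hper l hl _ ξ hξ hξe] with z hz
      simp only [hu, hz])
    (fun l hl => by
      filter_upwards [hper l hl _ ξ hξ hξe, hper l hl _ η hη hηe] with z hz hz'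
      simp only [hv, hz, hz'])
  obtain ⟨c, hc0, hc⟩ := h₂.exists_deriv_eq
  obtain ⟨β, hβ, hlift⟩ := exists_affine_of_deriv_eq_mul hc0 (S := (lattice τ₂ : Set ℂ)ᶜ) hum hvm
    h₂.meromorphic_shortX h₂.meromorphic_shortY huv hv0 hκ h₂.analyticAt_shortX h₂.analyticAt_shortY
    (fun z hz => by
      filter_upwards [eventually_nhds_notMem_lattice hz] with w hw using h₂.short_eq w hw)
    (fun z hz => by
      filter_upwards [eventually_nhds_notMem_lattice hz] with w hw using hc w hw)
    h₂.surj_short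
  -- If κ = 0 the affine map is the constant β, which was chosen outside the lattice. That κ ≠ 0 is
  -- only established later, by counting.
  have hnm : ∀ᶠ z in codiscrete ℂ, κ / c * z + β ∉ lattice τ₂ := by
    by_cases hκ0 : κ = 0
    · have := hβ hκ0
      refine Eventually.of_forall fun z => ?_
      rw [hκ0, zero_div, zero_mul, zero_add]
      exact this
    · exact eventually_codiscrete_affine (div_ne_zero hκ0 hc0) β (eventually_notMem_lattice τ₂)
  refine ⟨κ / c, β, (hG.union (countable_not_of_eventually_codiscrete (hlift.and hnm))).mono ?_⟩
  intro z hz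
  by_contra hcon
  simp only [Set.mem_union, Set.mem_ofPred_eq, not_or, not_not] at hcon
  obtain ⟨⟨hz1, hz2⟩, ⟨hz3, hz4⟩, hz5⟩ := hcon
  obtain ⟨e1, e2⟩ := short_inj E hz3 hz4
  exact hz ⟨hz1, hz5, hz2, (hξe z hz2).trans e1, (hηe z hz2).trans e2⟩

/-! ### Period lattices and the kernel of the lifted map -/

section Lift

variable [IsAlgClosed F] {φ : Isogeny W₁ W₂} {α β : ℂ}

lemma countable_not_add {p : ℂ → Prop} (h : {z | ¬ p z}.Countable) (t : ℂ) :
    {z | ¬ p (z + t)}.Countable :=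
  h.preimage (f := fun z => z + t) (add_left_injective t)

/-- z and z + l give the same point of the first curve, hence the same image, and the second
uniformization is injective modulo its lattice. -/
lemma mul_mem_lattice_of_lift (h₁ : Uniformization (W₁.map s) τ₁ X₁ Y₁)
    (h₂ : Uniformization (W₂.map s) τ₂ X₂ Y₂)
    (hl : {z | ¬ IsLiftPoint s φ τ₁ τ₂ X₁ Y₁ X₂ Y₂ α β z}.Countable) :
    ∀ l ∈ lattice τ₁, α * l ∈ lattice τ₂ := by
  intro l hlm
  obtain ⟨z, hz, hz'⟩ := exists_of_countable_not
    (p := fun z => IsLiftPoint s φ τ₁ τ₂ X₁ Y₁ X₂ Y₂ α β z ∧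
      IsLiftPoint s φ τ₁ τ₂ X₁ Y₁ X₂ Y₂ α β (z + l)) (by
      refine (hl.union (countable_not_add hl l)).mono ?_
      intro z hz
      rw [Set.mem_ofPred_eq, not_and_or] at hz
      exact hz)
  obtain ⟨a1, a2, a3, a4, a5⟩ := hz
  obtain ⟨b1, b2, b3, b4, b5⟩ := hz'
  obtain ⟨hx, hy⟩ := h₁.add_period z a1 l hlm
  have he := evalFunctionField_congr b3 a3 hx hy
  have := h₂.inj _ b2 _ a2 (by rw [← b4, ← a4, he]) (by rw [← b5, ← a5, he])
  have h3 : α * (z + l) + β - (α * z + β) = α * l := by ring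
  rwa [h3] at this

/-- Evaluation at the points z + tᵢ gives embeddings of the function field into ℂ. They are distinct
since the tᵢ are distinct modulo the first lattice, and agree on pullbacks since the αtᵢ lie in the
second. -/
lemma card_le_degree_of_lift (h₁ : Uniformization (W₁.map s) τ₁ X₁ Y₁)
    (h₂ : Uniformization (W₂.map s) τ₂ X₂ Y₂)
    (hl : {z | ¬ IsLiftPoint s φ τ₁ τ₂ X₁ Y₁ X₂ Y₂ α β z}.Countable)
    {ι : Type*} [Fintype ι] (t : ι → ℂ) (ht : ∀ i, α * t i ∈ lattice τ₂)
    (hinj : ∀ i j, t i - t j ∈ lattice τ₁ → i = j) : Fintype.card ι ≤ φ.degree := by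
  obtain ⟨z, hz⟩ := exists_of_countable_not
    (p := fun z => ∀ i, IsLiftPoint s φ τ₁ τ₂ X₁ Y₁ X₂ Y₂ α β (z + t i)) (by
      refine (Set.countable_iUnion fun i => countable_not_add hl (t i)).mono ?_
      intro z hz
      rw [Set.mem_ofPred_eq, not_forall] at hz
      exact Set.mem_iUnion.2 hz)
  choose a1 a2 a3 a4 a5 using hz
  refine card_le_degree φ (fun i => evalFunctionField (a3 i)) ?_ ?_
  · intro i j hij
    have hx := congrArg (fun f => f (xFunction W₁)) hij
    have hy := congrArg (fun f => f (yFunction W₁)) hij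
    simp only [evalFunctionField_xFunction, evalFunctionField_yFunction] at hx hy
    have := h₁.inj _ (a1 i) _ (a1 j) hx hy
    rw [add_sub_add_left_eq_sub] at this
    exact hinj i j this
  · intro i j g
    have hmem : α * t i - α * t j ∈ lattice τ₂ := sub_mem (ht i) (ht j)
    have hp := h₂.add_period _ (a2 j) _ hmem
    have h3 : α * (z + t j) + β + (α * t i - α * t j) = α * (z + t i) + β := by ring
    rw [h3] at hp
    let ψ : W₂.toAffine.FunctionField →+* W₁.toAffine.FunctionField := φ.pullback
    have := functionField_ringHom_ext (W := W₂) (f := (evalFunctionField (a3 i)).comp ψ)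
      (g := (evalFunctionField (a3 j)).comp ψ)
      (fun a => by simp [ψ, evalFunctionField_const])
      (by simp only [RingHom.comp_apply, RingHom.coe_coe, ψ]; rw [a4, a4, hp.1])
      (by simp only [RingHom.comp_apply, RingHom.coe_coe, ψ]; rw [a5, a5, hp.2])
    exact RingHom.congr_fun this g

/-- If α were 0 every translation would count as an element of the kernel; deg φ + 1 equally spaced
real points already exceed the bound. -/
lemma ne_zero_of_lift (h₁ : Uniformization (W₁.map s) τ₁ X₁ Y₁)
    (h₂ : Uniformization (W₂.map s) τ₂ X₂ Y₂)
    (hl : {z | ¬ IsLiftPoint s φ τ₁ τ₂ X₁ Y₁ X₂ Y₂ α β z}.Countable) : α ≠ 0 := by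
  rintro rfl
  have := card_le_degree_of_lift h₁ h₂ hl
    (fun i : Fin (φ.degree + 1) => (((i : ℝ) / (φ.degree + 1) : ℝ) : ℂ)) (fun i => by simp) (by
      intro i j hij
      rw [← Complex.ofReal_sub, mem_lattice_real_iff] at hij
      obtain ⟨m, hm⟩ := hij
      have hpos : (0 : ℝ) < φ.degree + 1 := by positivity
      have h3 : ((m * (φ.degree + 1) : ℤ) : ℝ) = (((i : ℕ) : ℤ) - ((j : ℕ) : ℤ) : ℤ) := by
        push_cast
        field_simp at hm
        linarith
      have h4 : m * ((φ.degree : ℤ) + 1) = ((i : ℕ) : ℤ) - ((j : ℕ) : ℤ) := by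
        exact_mod_cast h3
      have hi := i.2
      have hj := j.2
      have hm0 : m = 0 := by
        by_contra hm0
        rcases lt_or_gt_of_ne hm0 with h | h
        · nlinarith
        · nlinarith
      subst hm0
      ext
      omega)
  simp at this

end Lift

end

/-! ### The first inequality -/

/-- The bounds on |Re τ| and |τ| give |a + bτ|² ≥ a² - |a||b| + b², a positive integer. -/
lemma one_le_normSq_of_mem_fd {τ : ℍ} (hτ : τ ∈ 𝒟) {a b : ℤ} (hab : (a : ℂ) + b * τ ≠ 0) :
    1 ≤ Complex.normSq ((a : ℂ) + b * τ) := by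
  obtain ⟨h1, h2⟩ := hτ
  have hk : 0 < a ^ 2 - |a| * |b| + b ^ 2 := by
    have h0 : a ≠ 0 ∨ b ≠ 0 := by
      by_contra! hc
      exact hab (by simp [hc.1, hc.2])
    have ha := sq_abs a
    have hb := sq_abs b
    rcases h0 with h0 | h0
    · have := abs_pos.2 h0
      nlinarith [sq_nonneg (2 * |b| - |a|)]
    · have := abs_pos.2 h0
      nlinarith [sq_nonneg (2 * |a| - |b|)]
  have hk' : (1 : ℝ) ≤ a ^ 2 - |(a : ℝ)| * |(b : ℝ)| + b ^ 2 := by exact_mod_cast hk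
  have hn : Complex.normSq (τ : ℂ) = τ.re * τ.re + τ.im * τ.im := by
    rw [Complex.normSq_apply]; rfl
  have he : Complex.normSq ((a : ℂ) + b * τ) =
      a ^ 2 + 2 * (a * b * τ.re) + b ^ 2 * Complex.normSq (τ : ℂ) := by
    rw [hn, Complex.normSq_apply]
    simp
    ring
  have hab2 : |(a : ℝ) * b * τ.re| ≤ |(a : ℝ)| * |(b : ℝ)| * (1 / 2) := by
    rw [abs_mul, abs_mul]
    gcongr
  have := (abs_le.1 hab2).1
  have hb2 : (b : ℝ) ^ 2 * 1 ≤ b ^ 2 * Complex.normSq (τ : ℂ) :=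
    mul_le_mul_of_nonneg_left h1 (sq_nonneg _)
  rw [he]
  linarith

/-- The index of a sublattice of `ℤ²` is the absolute value of its determinant. -/
lemma card_quotient_range (A : Matrix (Fin 2) (Fin 2) ℤ) (hA : A.det ≠ 0) :
    Nat.card ((Fin 2 → ℤ) ⧸ LinearMap.range (Matrix.toLin' A)) = A.det.natAbs := by
  have hinj : Function.Injective (Matrix.toLin' A) := by
    rw [injective_iff_map_eq_zero]
    intro v hv
    exact Matrix.eq_zero_of_mulVec_eq_zero hA (by rwa [Matrix.toLin'_apply] at hv)
  have := Submodule.natAbs_det_equiv (LinearMap.range (Matrix.toLin' A))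
    (LinearEquiv.ofInjective (Matrix.toLin' A) hinj)
  rw [← this, ← LinearMap.det_toLin' A]
  congr 2

lemma im_div_im_le {τ₁ τ₂ : ℍ} (hτ₂ : τ₂ ∈ 𝒟) {α : ℂ} (hα : α ≠ 0)
    (hmul : ∀ l ∈ lattice τ₁, α * l ∈ lattice τ₂) {N : ℕ}
    (hcard : ∀ (ι : Type) [Fintype ι] (t : ι → ℂ), (∀ i, α * t i ∈ lattice τ₂) →
      (∀ i j, t i - t j ∈ lattice τ₁ → i = j) → Fintype.card ι ≤ N) :
    τ₁.im / τ₂.im ≤ N := by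
  obtain ⟨a, b, hab⟩ := mem_lattice_iff.1 (hmul 1 (mem_lattice_iff.2 ⟨1, 0, by simp⟩))
  obtain ⟨c, d, hcd⟩ := mem_lattice_iff.1 (hmul τ₁ (mem_lattice_iff.2 ⟨0, 1, by simp⟩))
  rw [mul_one] at hab
  have hα1 : 1 ≤ Complex.normSq α := by
    rw [← hab]
    exact one_le_normSq_of_mem_fd hτ₂ (by rwa [hab])
  -- compare covolumes
  have hdet : Complex.normSq α * τ₁.im = ((a * d - b * c : ℤ) : ℝ) * τ₂.im := by
    have h1 : (starRingEnd ℂ α * (α * τ₁)).im = Complex.normSq α * τ₁.im := by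
      rw [← mul_assoc, mul_comm (starRingEnd ℂ α), Complex.mul_conj, Complex.im_ofReal_mul]
      rfl
    rw [← h1, ← hcd, ← hab]
    simp
    ring
  have hpos : (0 : ℝ) < ((a * d - b * c : ℤ) : ℝ) := by
    have : 0 < ((a * d - b * c : ℤ) : ℝ) * τ₂.im := by
      rw [← hdet]
      exact mul_pos (lt_of_lt_of_le one_pos hα1) τ₁.im_pos
    exact (pos_iff_pos_of_mul_pos this).2 τ₂.im_pos
  have hposZ : 0 < a * d - b * c := by exact_mod_cast hpos
  set A : Matrix (Fin 2) (Fin 2) ℤ := !![a, c; b, d] with hA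
  have hAdet : A.det = a * d - b * c := by rw [hA, Matrix.det_fin_two_of]; ring
  have hAc := card_quotient_range A (by rw [hAdet]; exact hposZ.ne')
  set Q := (Fin 2 → ℤ) ⧸ LinearMap.range (Matrix.toLin' A)
  have : Finite Q := Nat.finite_of_card_ne_zero (by
    rw [hAc, hAdet]
    exact Int.natAbs_ne_zero.2 hposZ.ne')
  have : Fintype Q := Fintype.ofFinite Q
  -- Representatives of Λ₂/αΛ₁, divided by α, represent the kernel α⁻¹Λ₂/Λ₁.
  have hle := hcard Q (fun q => ((q.out 0 : ℤ) + (q.out 1 : ℤ) * (τ₂ : ℂ)) / α)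
    (fun q => by
      rw [mul_div_cancel₀ _ hα]
      exact mem_lattice_iff.2 ⟨_, _, rfl⟩)
    (fun q r hqr => by
      obtain ⟨m, n, hmn⟩ := mem_lattice_iff.1 hqr
      have h1 : ((q.out 0 - r.out 0 - (a * m + c * n) : ℤ) : ℂ) +
          ((q.out 1 - r.out 1 - (b * m + d * n) : ℤ) : ℂ) * τ₂ = 0 := by
        field_simp at hmn
        push_cast
        linear_combination -hmn - m * hab - n * hcd
      have h2 : q.out 1 - r.out 1 - (b * m + d * n) = 0 := by
        have := congrArg Complex.im h1
        rw [Complex.add_im, Complex.intCast_im, zero_add, ← Complex.ofReal_intCast,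
          Complex.im_ofReal_mul] at this
        have h3 := (mul_eq_zero.1 this).resolve_right τ₂.im_ne_zero
        exact_mod_cast h3
      rw [h2, Int.cast_zero, zero_mul, add_zero, Int.cast_eq_zero] at h1
      rw [← q.out_eq, ← r.out_eq]
      refine (Submodule.Quotient.eq _).2 ⟨![m, n], ?_⟩
      rw [Matrix.toLin'_apply]
      ext i
      fin_cases i
      · simp [hA, Matrix.mulVec, dotProduct]
        linear_combination -h1
      · simp [hA, Matrix.mulVec, dotProduct]
        linear_combination -h2)
  rw [← Nat.card_eq_fintype_card, hAc, hAdet] at hle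
  have hle' : ((a * d - b * c : ℤ) : ℝ) ≤ N := by
    have : a * d - b * c ≤ N := by omega
    exact_mod_cast this
  rw [div_le_iff₀ τ₂.im_pos]
  calc τ₁.im = 1 * τ₁.im := (one_mul _).symm
    _ ≤ Complex.normSq α * τ₁.im := by gcongr
    _ = ((a * d - b * c : ℤ) : ℝ) * τ₂.im := hdet
    _ ≤ N * τ₂.im := by gcongr

lemma countable_of_isAlgebraic (R A : Type*) [Field R] [Field A] [Algebra R A] [Countable R]
    [Algebra.IsAlgebraic R A] : Countable A := by
  have h := Algebraic.countable R A
  rw [show {x : A | IsAlgebraic R x} = Set.univ from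
    Set.eq_univ_of_forall fun x => Algebra.IsAlgebraic.isAlgebraic x] at h
  exact Set.countable_univ_iff.1 h

section NumberField

variable {K : Type*} [Field K] [NumberField K]

lemma im_div_im_le_degree (E₁ E₂ : WeierstrassCurve K) [E₁.IsElliptic] [E₂.IsElliptic]
    (φ : Isogeny (E₁.baseChange (AlgebraicClosure K)) (E₂.baseChange (AlgebraicClosure K)))
    (σ : K →+* ℂ) {τ₁ τ₂ : ℍ} (h₁ : IsUniformizedBy (E₁.map σ) τ₁)
    (h₂ : IsUniformizedBy (E₂.map σ) τ₂) (hτ₂ : τ₂ ∈ 𝒟) : τ₁.im / τ₂.im ≤ φ.degree := by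
  let _ := σ.toAlgebra
  -- φ lives over the algebraic closure, so σ is extended to it; any extension will do, since the
  -- base-changed curves depend only on σ.
  let s : AlgebraicClosure K →ₐ[K] ℂ := IsAlgClosed.lift
  have hs : (s : AlgebraicClosure K →+* ℂ).comp (algebraMap K (AlgebraicClosure K)) = σ :=
    s.comp_algebraMap
  have hmap : ∀ E : WeierstrassCurve K,
      (E.baseChange (AlgebraicClosure K)).map (s : AlgebraicClosure K →+* ℂ) = E.map σ := fun E => by
    rw [← hs, ← WeierstrassCurve.map_map]
    rfl
  have hell : ∀ E : WeierstrassCurve K, [E.IsElliptic] →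
      ((E.baseChange (AlgebraicClosure K)).map (s : AlgebraicClosure K →+* ℂ)).IsElliptic :=
    fun E _ => by rw [hmap]; infer_instance
  have := hell E₁
  have := hell E₂
  rw [← hmap] at h₁ h₂
  obtain ⟨X₁, Y₁, u₁⟩ := exists_uniformization h₁
  obtain ⟨X₂, Y₂, u₂⟩ := exists_uniformization h₂
  have : Countable K := countable_of_isAlgebraic ℚ K
  have : Countable (AlgebraicClosure K) := countable_of_isAlgebraic K _
  have : CharZero (AlgebraicClosure K) := charZero_of_injective_algebraMap
    (algebraMap K (AlgebraicClosure K)).injective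
  obtain ⟨α, β, hl⟩ := exists_lift u₁ u₂ φ
  exact im_div_im_le hτ₂ (ne_zero_of_lift u₁ u₂ hl) (mul_mem_lattice_of_lift u₁ u₂ hl)
    fun ι _ t ht hinj => card_le_degree_of_lift u₁ u₂ hl t ht hinj

lemma alpha_le_log_degree (E₁ E₂ : WeierstrassCurve K) [E₁.IsElliptic] [E₂.IsElliptic]
    (φ : Isogeny (E₁.baseChange (AlgebraicClosure K)) (E₂.baseChange (AlgebraicClosure K)))
    (τ₁ τ₂ : (K →+* ℂ) → ℍ) (h₁ : ∀ σ, IsUniformizedBy (E₁.map σ) (τ₁ σ))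
    (h₂ : ∀ σ, IsUniformizedBy (E₂.map σ) (τ₂ σ)) (hτ₂ : ∀ σ, τ₂ σ ∈ 𝒟) :
    alpha τ₁ τ₂ ≤ 1 / 2 * Real.log (φ.degree : ℝ) := by
  have hd : (0 : ℝ) < Module.finrank ℚ K := by exact_mod_cast Module.finrank_pos
  have hsum : ∑ σ : K →+* ℂ, Real.log ((τ₁ σ).im / (τ₂ σ).im) ≤
      Module.finrank ℚ K * Real.log (φ.degree : ℝ) := by
    calc _ ≤ ∑ σ : K →+* ℂ, Real.log (φ.degree : ℝ) := by
          refine Finset.sum_le_sum fun σ _ => Real.log_le_log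
            (div_pos (τ₁ σ).im_pos (τ₂ σ).im_pos)
            (im_div_im_le_degree E₁ E₂ φ σ (h₁ σ) (h₂ σ) (hτ₂ σ))
      _ = _ := by
          rw [Finset.sum_const, Finset.card_univ, NumberField.Embeddings.card, nsmul_eq_mul]
  rw [alpha]
  calc _ ≤ 1 / (2 * (Module.finrank ℚ K : ℝ)) *
        (Module.finrank ℚ K * Real.log (φ.degree : ℝ)) := by gcongr
    _ = _ := by field_simp

end NumberField

/-! ### Comparison with the Weierstrass function -/

lemma exists_tendsto_sq_mul {f : ℂ → ℂ} (hf : MeromorphicAt f 0)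
    (h : meromorphicOrderAt f 0 = ((-2 : ℤ) : WithTop ℤ)) :
    ∃ c ≠ 0, Tendsto (fun z => z ^ 2 * f z) (𝓝[≠] 0) (𝓝 c) := by
  obtain ⟨g, hg, hg0, he⟩ := (meromorphicOrderAt_eq_int_iff hf).1 h
  refine ⟨g 0, hg0, (hg.continuousAt.tendsto.mono_left nhdsWithin_le_nhds).congr' ?_⟩
  filter_upwards [he, self_mem_nhdsWithin] with z h1 hz
  have hz' : z ≠ 0 := hz
  rw [h1]
  simp [zpow_neg]
  field_simp

/-- An even function has no simple pole at the origin. -/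
lemma order_nonneg_of_even {f : ℂ → ℂ} (hf : MeromorphicAt f 0)
    (heven : ∀ᶠ z in 𝓝[≠] 0, f (-z) = f z)
    (h : Tendsto (fun z => z ^ 2 * f z) (𝓝[≠] 0) (𝓝 0)) : 0 ≤ meromorphicOrderAt f 0 := by
  have hm : MeromorphicAt (fun z : ℂ => z) 0 := by fun_prop
  have hid : meromorphicOrderAt (fun z : ℂ => z) 0 = ((1 : ℤ) : WithTop ℤ) := by
    rw [meromorphicOrderAt_eq_int_iff hm]
    exact ⟨fun _ => 1, analyticAt_const, one_ne_zero, by simp⟩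
  have h2 : meromorphicOrderAt (fun z => z * (z * f z)) 0 =
      meromorphicOrderAt f 0 + ((2 : ℤ) : WithTop ℤ) := by
    have e1 := meromorphicOrderAt_mul hm (hm.mul hf)
    have e2 := meromorphicOrderAt_mul hm hf
    rw [e2, hid] at e1
    change meromorphicOrderAt (fun z => z * (z * f z)) 0 = _ at e1
    rw [e1, ← add_assoc, ← WithTop.coe_add, add_comm]
    rfl
  have h3 : meromorphicOrderAt (fun z => z * f z) 0 =
      meromorphicOrderAt f 0 + ((1 : ℤ) : WithTop ℤ) := by
    have e2 := meromorphicOrderAt_mul hm hf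
    rw [hid, add_comm] at e2
    exact e2
  have h4 : 0 < meromorphicOrderAt (fun z => z * (z * f z)) 0 := by
    rw [← tendsto_zero_iff_meromorphicOrderAt_pos (by fun_prop)]
    refine h.congr fun z => by ring
  rw [h2] at h4
  by_contra! hneg
  induction hn : meromorphicOrderAt f 0 with
  | top => rw [hn] at hneg; simp at hneg
  | coe n =>
    rw [hn, ← WithTop.coe_add] at h4
    rw [hn] at hneg h3
    have h5 : 0 < n + 2 := by exact_mod_cast h4
    have h6 : n < 0 := by exact_mod_cast hneg
    obtain rfl : n = -1 := by omega
    obtain ⟨c, hc, hlim⟩ := tendsto_ne_zero_of_meromorphicOrderAt_eq_zero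
      (f := fun z => z * f z) (x := 0) (by fun_prop) (by rw [h3, ← WithTop.coe_add]; rfl)
    have hnegt : Tendsto (fun z : ℂ => -z) (𝓝[≠] 0) (𝓝[≠] 0) := by
      refine tendsto_nhdsWithin_of_tendsto_nhds_of_eventually_within _ ?_ ?_
      · simpa using (continuous_neg (G := ℂ)).continuousAt.tendsto.mono_left
          (nhdsWithin_le_nhds (a := (0 : ℂ)) (s := {0}ᶜ))
      · filter_upwards [self_mem_nhdsWithin] with z hz
        simpa using hz
    have hlim2 : Tendsto (fun z => z * f z) (𝓝[≠] 0) (𝓝 (-c)) := by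
      refine (hlim.comp hnegt).neg.congr' ?_
      filter_upwards [heven] with z hz
      simp [hz]
    have := tendsto_nhds_unique hlim hlim2
    exact hc (by linear_combination this / 2)

lemma order_add_period {τ : ℍ} {f : ℂ → ℂ}
    (hper : ∀ l ∈ lattice τ, ∀ᶠ z in codiscrete ℂ, f (z + l) = f z) {l : ℂ} (hl : l ∈ lattice τ) :
    meromorphicOrderAt f l = meromorphicOrderAt f 0 := by
  have h1 := meromorphicOrderAt_congr (eventually_codiscrete_iff.1 (hper l hl) 0)
  rw [← h1]
  have := meromorphicOrderAt_comp_add_const_eq_meromorphicOrderAt (f := f) (c := l) (x := 0)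
  simpa [Function.comp_def] using this.symm

open PeriodPair in
lemma analyticAt_weierstrassP {τ : ℍ} {z : ℂ} (hz : z ∉ lattice τ) :
    AnalyticAt ℂ ℘[periods τ] z :=
  (periods τ).analyticOnNhd_weierstrassP z (by simpa [mem_periods_lattice] using hz)

namespace Uniformization

variable {E : WeierstrassCurve ℂ} {τ : ℍ} {X Y : ℂ → ℂ}

lemma shortX_add_period (h : Uniformization E τ X Y) {l : ℂ} (hl : l ∈ lattice τ) :
    ∀ᶠ z in codiscrete ℂ, shortX E (X (z + l)) = shortX E (X z) := by
  filter_upwards [eventually_notMem_lattice τ] with z hz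
  rw [(h.add_period z hz l hl).1]

/-- There must be a pole, or u would be constant. If it has order n, then v has order 3n/2 by the
equation and n - 1 by u' = cv, which forces n = -2. -/
lemma order_shortX [E.IsElliptic] (h : Uniformization E τ X Y) :
    meromorphicOrderAt (fun z => shortX E (X z)) 0 = ((-2 : ℤ) : WithTop ℤ) := by
  have hneg : meromorphicOrderAt (fun z => shortX E (X z)) 0 < 0 := by
    by_contra! hc
    obtain ⟨c, hc⟩ := exists_eq_const_of_periodic τ h.meromorphic_shortX (fun x => by
      by_cases hx : x ∈ lattice τ
      · rw [order_add_period (fun l hl => h.shortX_add_period hl) hx]; exact hc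
      · exact (h.analyticAt_shortX x hx).meromorphicOrderAt_nonneg)
      (fun l hl => h.shortX_add_period hl)
    obtain ⟨z, hz⟩ := exists_of_countable_not
      (countable_not_of_eventually_codiscrete (hc.and (h.ne_const (c - E.b₂ / 12))))
    exact hz.2 (by rw [← hz.1]; simp [shortX])
  induction hn : meromorphicOrderAt (fun z => shortX E (X z)) 0 with
  | top => rw [hn] at hneg; simp at hneg
  | coe n =>
    rw [hn] at hneg
    have hn0 : n < 0 := by exact_mod_cast hneg
    have hoff := eventually_codiscrete_iff.1 (eventually_notMem_lattice τ) 0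
    obtain ⟨k, hk, hkn⟩ := order_of_weierstrass_eq (h.meromorphic_shortX 0) (h.meromorphic_shortY 0)
      (by filter_upwards [hoff] with z hz using h.short_eq z hz) hn hn0
    obtain ⟨c, hc, hd⟩ := h.exists_deriv_eq
    have h1 : meromorphicOrderAt (deriv fun z => shortX E (X z)) 0 = ((n - 1 : ℤ) : WithTop ℤ) :=
      meromorphicOrderAt_deriv_eq_sub_one (by exact_mod_cast hn0.ne) hn
    have h2 : meromorphicOrderAt (fun z => c * shortY E (X z) (Y z)) 0 = (k : WithTop ℤ) := by
      have e := meromorphicOrderAt_mul (f := fun _ => c) (MeromorphicAt.const c 0)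
        (h.meromorphic_shortY 0)
      change meromorphicOrderAt (fun z => c * shortY E (X z) (Y z)) 0 = _ at e
      rw [e, hk, meromorphicOrderAt_const, if_neg hc, zero_add]
    rw [meromorphicOrderAt_congr (f₂ := fun z => c * shortY E (X z) (Y z))
      (by filter_upwards [hoff] with z hz using hd z hz), h2] at h1
    have h3 : k = n - 1 := by exact_mod_cast h1
    congr 1
    omega

open PeriodPair in
/-- The coordinate `u` of a uniformized curve is an affine function of `℘`. -/
lemma exists_shortX_eq_weierstrassP [E.IsElliptic] (h : Uniformization E τ X Y) :
    ∃ a C, a ≠ 0 ∧ ∀ z, z ∉ lattice τ → shortX E (X z) = a * ℘[periods τ] z + C := by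
  have h0 : (0 : ℂ) ∈ lattice τ := zero_mem _
  have hPm := (periods τ).meromorphic_weierstrassP
  have hXm := h.meromorphic_shortX
  obtain ⟨b, hb, hlim⟩ := exists_tendsto_sq_mul (hPm 0)
    (by rw [(periods τ).order_weierstrassP 0 (mem_periods_lattice.2 h0)]; rfl)
  obtain ⟨b', hb', hlim'⟩ := exists_tendsto_sq_mul (hXm 0) h.order_shortX
  -- The factor b'/b cancels the z⁻² terms. Evenness rules out a remaining simple pole, so D is
  -- periodic without poles, hence constant.
  set D : ℂ → ℂ := fun z => shortX E (X z) - b' / b * ℘[periods τ] z with hD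
  have hDm : Meromorphic D := by
    rw [hD]; fun_prop
  have hper : ∀ l ∈ lattice τ, ∀ᶠ z in codiscrete ℂ, D (z + l) = D z := by
    intro l hl
    filter_upwards [h.shortX_add_period hl] with z hz
    simp only [hD, hz]
    rw [(periods τ).weierstrassP_add_coe z ⟨l, mem_periods_lattice.2 hl⟩]
  have hord0 : 0 ≤ meromorphicOrderAt D 0 := by
    refine order_nonneg_of_even (hDm 0) ?_ ?_
    · filter_upwards [eventually_codiscrete_iff.1 (eventually_notMem_lattice τ) 0] with z hz
      simp only [hD]
      rw [h.even z hz, (periods τ).weierstrassP_neg]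
    · have h2 := hlim'.sub (hlim.const_mul (b' / b))
      rw [div_mul_cancel₀ _ hb, sub_self] at h2
      exact h2.congr fun z => by simp only [hD]; ring
  obtain ⟨C, hC⟩ := exists_eq_const_of_periodic τ hDm (fun x => by
    by_cases hx : x ∈ lattice τ
    · rw [order_add_period hper hx]; exact hord0
    · exact ((h.analyticAt_shortX x hx).sub
        (analyticAt_const.mul (analyticAt_weierstrassP hx))).meromorphicOrderAt_nonneg) hper
  refine ⟨b' / b, C, div_ne_zero hb' hb, fun z hz => ?_⟩
  have h3 : D z = C := eq_of_eventually_codiscrete (g := fun _ => C)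
    ((h.analyticAt_shortX z hz).sub
        (analyticAt_const.mul (analyticAt_weierstrassP hz))).continuousAt continuousAt_const hC
  simp only [hD] at h3
  linear_combination h3

open PeriodPair in
/-- The invariants of a uniformized curve agree with those of the lattice up to scaling. -/
lemma exists_invariants_eq [E.IsElliptic] (h : Uniformization E τ X Y) :
    ∃ c ≠ 0, (periods τ).g₂ = c ^ 4 * shortG₂ E ∧ (periods τ).g₃ = c ^ 6 * shortG₃ E := by
  obtain ⟨a, C, ha, hX⟩ := h.exists_shortX_eq_weierstrassP
  obtain ⟨c, hc, hd⟩ := h.exists_deriv_eq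
  -- Two expressions for the square of u' as a function of p = ℘(z). As u takes every value, this is
  -- a polynomial identity in p, whose coefficients are extracted by finite differences over -1, 0,
  -- 1, 2.
  have key : ∀ p : ℂ, a ^ 2 * (4 * p ^ 3 - (periods τ).g₂ * p - (periods τ).g₃) =
      c ^ 2 * (4 * (a * p + C) ^ 3 - shortG₂ E * (a * p + C) - shortG₃ E) := by
    intro p
    obtain ⟨z, hz, hzp⟩ := h.exists_shortX_eq (a * p + C)
    have h1 := hX z hz
    have h2 : ℘[periods τ] z = p := by
      rw [hzp] at h1
      exact mul_left_cancel₀ ha (by linear_combination -h1)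
    have h3 : deriv (fun z => shortX E (X z)) z = a * ℘'[periods τ] z := by
      have e : (fun z => shortX E (X z)) =ᶠ[𝓝 z] fun z => a * ℘[periods τ] z + C := by
        filter_upwards [eventually_nhds_notMem_lattice hz] with w hw using hX w hw
      rw [e.deriv_eq, deriv_add_const, deriv_const_mul _ (analyticAt_weierstrassP hz).differentiableAt,
        (periods τ).deriv_weierstrassP]
    have h4 := (periods τ).derivWeierstrassP_sq z (by rw [mem_periods_lattice]; exact hz)
    have h5 := h.short_eq z hz
    have h6 := hd z hz
    rw [h3] at h6
    rw [hzp] at h5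
    rw [← h2, ← h4, h2, ← h5]
    linear_combination (a * ℘'[periods τ] z + c * shortY E (X z) (Y z)) * h6
  have k0 := key 0
  have k1 := key 1
  have k2 := key (-1)
  have k3 := key 2
  -- the coefficients of `p ^ 3`, `p ^ 2`, `p`
  have e3 : a ^ 2 = c ^ 2 * a ^ 3 := by linear_combination (k3 - 3 * k1 + 3 * k0 - k2) / 24
  have e3' : c ^ 2 * a = 1 := by
    have : a ^ 2 * (c ^ 2 * a) = a ^ 2 * 1 := by linear_combination -e3
    exact mul_left_cancel₀ (pow_ne_zero 2 ha) this
  have hC : C = 0 := by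
    have : (a * 12) * C = 0 := by
      linear_combination -(k1 + k2 - 2 * k0) / 2 - 12 * a * C * (e3')
    simpa [ha] using this
  subst hC
  refine ⟨c, hc, ?_, ?_⟩
  · have : a ^ 2 * (periods τ).g₂ = a ^ 2 * (c ^ 4 * shortG₂ E) := by
      linear_combination -(k1 - k2) / 2 + 4 * e3 - c ^ 2 * a * shortG₂ E * e3'
    exact mul_left_cancel₀ (pow_ne_zero 2 ha) this
  · have : a ^ 2 * (periods τ).g₃ = a ^ 2 * (c ^ 6 * shortG₃ E) := by
      linear_combination -k0 - c ^ 2 * shortG₃ E * (c ^ 2 * a + 1) * e3'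
    exact mul_left_cancel₀ (pow_ne_zero 2 ha) this

end Uniformization

/-- The left side is the archimedean part of the height, the multiplicity of a place being its
number of embeddings. The finite places contribute nonnegative terms. -/
lemma sum_logPlus_embeddings_le {K : Type*} [Field K] [NumberField K] (x : K) :
    ∑ σ : K →+* ℂ, Real.posLog ‖σ x‖ ≤ Height.logHeight₁ x := by
  classical
  rw [NumberField.logHeight₁_eq]
  have h1 : ∑ σ : K →+* ℂ, Real.posLog ‖σ x‖ =
      ∑ v : NumberField.InfinitePlace K, v.mult * Real.posLog (v x) := by
    rw [← Finset.sum_fiberwise (s := Finset.univ) (g := NumberField.InfinitePlace.mk)]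
    refine Finset.sum_congr rfl fun v _ => ?_
    rw [← NumberField.InfinitePlace.card_filter_mk_eq v, ← nsmul_eq_mul]
    refine Finset.sum_eq_card_nsmul fun σ hσ => ?_
    rw [Finset.mem_filter] at hσ
    rw [← hσ.2, NumberField.InfinitePlace.apply]
  rw [h1]
  exact le_add_of_nonneg_right (finsum_nonneg fun v => Real.posLog_nonneg)

/-! ### q-expansions and the size of j near the cusp -/

lemma G_eq_tsum_eisSummand (τ : ℍ) (k : ℕ) :
    (periods τ).G k = ∑' v, EisensteinSeries.eisSummand k v τ := by
  rw [PeriodPair.G, ← (periods τ).latticeEquivProd.symm.toEquiv.tsum_eq,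
    -- The swap is needed because `eisSummand` puts the coefficient of τ first, while `periods`
    -- lists the period 1 first.
    ← ((finTwoArrowEquiv ℤ).trans (Equiv.prodComm ℤ ℤ)).symm.tsum_eq]
  refine tsum_congr fun x => ?_
  have := (periods τ).latticeEquiv_symm_apply x
  simp only [LinearEquiv.coe_toEquiv, this]
  simp [EisensteinSeries.eisSummand, periods, zpow_neg, add_comm]

lemma bernoulli_six : bernoulli 6 = 1 / 42 := by
  have h5 : bernoulli' 5 = 0 := bernoulli'_eq_zero_of_odd (by decide) (by norm_num)
  rw [bernoulli_eq_bernoulli'_of_ne_one (by norm_num), bernoulli'_def]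
  norm_num [Finset.sum_range_succ, h5, Nat.choose]

lemma riemannZeta_six : riemannZeta 6 = (Real.pi : ℂ) ^ 6 / 945 := by
  have := riemannZeta_two_mul_nat (k := 3) (by norm_num)
  norm_num [bernoulli_six, Nat.factorial] at this
  rw [this]; ring

open Complex ArithmeticFunction in
/-- The Lambert series `∑ σ_k(n) qⁿ`. -/
noncomputable def lambertSum (k : ℕ) (τ : ℍ) : ℂ :=
  ∑' n : ℕ+, (sigma k n : ℂ) * cexp (2 * Real.pi * I * τ) ^ (n : ℕ)

lemma g₂_periods (τ : ℍ) :
    (periods τ).g₂ = 4 * (Real.pi : ℂ) ^ 4 / 3 * (1 + 240 * lambertSum 3 τ) := by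
  have h := tsum_eisSummand_eq_tsum_sigma_mul_cexp_pow (k := 4) (by norm_num)
    (by decide) τ
  rw [PeriodPair.g₂, G_eq_tsum_eisSummand, h, lambertSum]
  norm_num [riemannZeta_four, Nat.factorial, mul_pow]
  ring

lemma g₃_periods (τ : ℍ) :
    (periods τ).g₃ = 8 * (Real.pi : ℂ) ^ 6 / 27 * (1 - 504 * lambertSum 5 τ) := by
  have h := tsum_eisSummand_eq_tsum_sigma_mul_cexp_pow (k := 6) (by norm_num)
    (by decide) τ
  have hI : Complex.I ^ 6 = -1 := by
    rw [show 6 = 2 * 3 by norm_num, pow_mul, Complex.I_sq]; norm_num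
  rw [PeriodPair.g₃, G_eq_tsum_eisSummand, h, lambertSum]
  norm_num [riemannZeta_six, Nat.factorial, mul_pow, hI]
  ring

lemma pow_le_two_pow_mul (k n : ℕ) (hn : 1 ≤ n) : n ^ k ≤ (2 ^ k) ^ (n - 1) := by
  rw [← pow_mul, mul_comm, pow_mul]
  gcongr
  have := Nat.lt_two_pow_self (n := n - 1)
  omega

/-- From σ_k(n) ≤ n^(k+1) and n ≤ 2^(n-1), the series is dominated by a geometric one of ratio
2^(k+1) r. -/
lemma norm_lambertSum_le (k : ℕ) (τ : ℍ) {r : ℝ}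
    (hr : ‖Complex.exp (2 * Real.pi * Complex.I * τ)‖ = r) (h : 2 ^ (k + 1) * r < 1) :
    ‖lambertSum k τ‖ ≤ r / (1 - 2 ^ (k + 1) * r) := by
  have hr0 : 0 ≤ r := hr ▸ norm_nonneg _
  have hs : HasSum (fun n : ℕ => r * (2 ^ (k + 1) * r) ^ n) (r / (1 - 2 ^ (k + 1) * r)) := by
    simpa [div_eq_mul_inv] using (hasSum_geometric_of_lt_one (by positivity) h).mul_left r
  rw [← Equiv.pnatEquivNat.hasSum_iff] at hs
  refine tsum_of_norm_bounded hs fun n => ?_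
  obtain ⟨m, hm⟩ : ∃ m, (n : ℕ) = m + 1 := ⟨n - 1, by have := n.pos; omega⟩
  have hm' : Equiv.pnatEquivNat n = m := by simp [Equiv.pnatEquivNat, PNat.natPred, hm]
  simp only [Function.comp_apply, hm', norm_mul, norm_pow, hr, hm, Complex.norm_natCast]
  have h1 : ((ArithmeticFunction.sigma k (m + 1) : ℕ) : ℝ) ≤ (2 ^ (k + 1)) ^ m := by
    exact_mod_cast (ArithmeticFunction.sigma_le_pow_succ k (m + 1)).trans
      (pow_le_two_pow_mul (k + 1) (m + 1) (by omega))
  calc ((ArithmeticFunction.sigma k (m + 1) : ℕ) : ℝ) * r ^ (m + 1)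
      ≤ (2 ^ (k + 1)) ^ m * r ^ (m + 1) := by gcongr
    _ = r * (2 ^ (k + 1) * r) ^ m := by rw [mul_pow]; ring

lemma norm_exp_two_pi_I_mul (τ : ℍ) :
    ‖Complex.exp (2 * Real.pi * Complex.I * τ)‖ = Real.exp (-(2 * Real.pi * τ.im)) := by
  rw [Complex.norm_exp]
  congr 1
  simp

/-- The `j`-invariant of a uniformized curve in terms of Eisenstein series. -/
lemma j_mul_eq {E : WeierstrassCurve ℂ} [E.IsElliptic] {τ : ℍ} (h : IsUniformizedBy E τ) :
    E.j * ((1 + 240 * lambertSum 3 τ) ^ 3 - (1 - 504 * lambertSum 5 τ) ^ 2) =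
      1728 * (1 + 240 * lambertSum 3 τ) ^ 3 := by
  obtain ⟨X, Y, hXY⟩ := exists_uniformization h
  obtain ⟨c, hc, h2, h3⟩ := hXY.exists_invariants_eq
  have hj : E.j * (shortG₂ E ^ 3 - 27 * shortG₃ E ^ 2) = 1728 * shortG₂ E ^ 3 := by
    have hΔ : E.Δ ≠ 0 := E.isUnit_Δ.ne_zero
    rw [short_discr, WeierstrassCurve.j, shortG₂, Units.val_inv_eq_inv_val,
      WeierstrassCurve.coe_Δ']
    field_simp
    norm_num
  have hj' : E.j * ((periods τ).g₂ ^ 3 - 27 * (periods τ).g₃ ^ 2) = 1728 * (periods τ).g₂ ^ 3 := by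
    rw [h2, h3]
    linear_combination c ^ 12 * hj
  rw [g₂_periods, g₃_periods] at hj'
  -- The common constant factor of g₂³ and 27g₃².
  have hpi : (64 * (Real.pi : ℂ) ^ 12 / 27) ≠ 0 := by
    have : (Real.pi : ℂ) ≠ 0 := Complex.ofReal_ne_zero.2 Real.pi_ne_zero
    simp [this]
  apply mul_left_cancel₀ hpi
  linear_combination hj'

/-- With E₄ = 1 + x and E₆ = 1 - y, where x and y are O(q), the denominator E₄³ - E₆² of j/1728 is
O(q) and E₄ stays away from 0. The constant 100 is far from sharp; it suffices that log 100 ≤ 5. -/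
lemma inv_le_norm_j {E : WeierstrassCurve ℂ} [E.IsElliptic] {τ : ℍ} (h : IsUniformizedBy E τ)
    {r : ℝ} (hr : ‖Complex.exp (2 * Real.pi * Complex.I * τ)‖ = r) (hr' : r ≤ 1 / 900) :
    1 ≤ 100 * r * ‖E.j‖ := by
  have hr0 : 0 ≤ r := hr ▸ norm_nonneg _
  have hj := j_mul_eq h
  set x := 240 * lambertSum 3 τ with hx
  set y := 504 * lambertSum 5 τ with hy
  have hx1 : ‖x‖ ≤ 250 * r := by
    have := norm_lambertSum_le 3 τ hr (by norm_num; linarith)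
    rw [hx, norm_mul]
    have h2 : r / (1 - 2 ^ (3 + 1) * r) ≤ 25 / 24 * r := by
      rw [div_le_iff₀ (by norm_num; linarith)]
      nlinarith
    norm_num
    linarith
  have hy1 : ‖y‖ ≤ 560 * r := by
    have := norm_lambertSum_le 5 τ hr (by norm_num; linarith)
    rw [hy, norm_mul]
    have h2 : r / (1 - 2 ^ (5 + 1) * r) ≤ 10 / 9 * r := by
      rw [div_le_iff₀ (by norm_num; linarith)]
      nlinarith
    norm_num
    linarith
  clear_value x y
  have hx0 := norm_nonneg x
  have hy0 := norm_nonneg y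
  have hA : 1 - ‖x‖ ≤ ‖1 + x‖ := by
    have := norm_sub_le (1 + x) x
    simp only [add_sub_cancel_right, norm_one] at this
    linarith
  have hA' : 1 / 3 ≤ ‖1 + x‖ ^ 3 := by
    have h1 : (7 / 10 : ℝ) ≤ ‖1 + x‖ := by linarith
    have := pow_le_pow_left₀ (by norm_num) h1 3
    norm_num at this
    linarith
  have hB : ‖(1 + x) ^ 3 - (1 - y) ^ 2‖ ≤ 3000 * r := by
    have e : (1 + x) ^ 3 - (1 - y) ^ 2 = x * (3 + 3 * x + x ^ 2) + y * (2 - y) := by ring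
    have e1 : ‖3 + 3 * x + x ^ 2‖ ≤ 4 := by
      refine (norm_add_le _ _).trans ?_
      have := norm_add_le 3 (3 * x)
      rw [norm_mul] at this
      rw [norm_pow]
      norm_num at this
      nlinarith
    have e2 : ‖2 - y‖ ≤ 3 := by
      refine (norm_sub_le _ _).trans ?_
      norm_num
      linarith
    rw [e]
    refine (norm_add_le _ _).trans ?_
    rw [norm_mul, norm_mul]
    nlinarith
  have h5 := congrArg norm hj
  rw [norm_mul, norm_mul, norm_pow] at h5
  norm_num at h5
  have h6 := mul_le_mul_of_nonneg_left hB (norm_nonneg E.j)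
  have hjr : 0 ≤ ‖E.j‖ * r := by positivity
  nlinarith

/-- The exponent is 2 · 0.97, twice the constant in the final bound. -/
lemma le_exp_mul : (6.9 : ℝ) ≤ Real.exp 1.94 := by
  have h1 := Real.exp_one_gt_d9
  have h2 : Real.exp 1.94 = Real.exp 1 * Real.exp 1 * Real.exp (-0.06) := by
    rw [← Real.exp_add, ← Real.exp_add]; norm_num
  have h3 := Real.add_one_le_exp (-0.06 : ℝ)
  rw [h2]
  have h4 : (7.38 : ℝ) ≤ Real.exp 1 * Real.exp 1 := by nlinarith
  nlinarith

lemma exp_five_gt : (140 : ℝ) ≤ Real.exp 5 := by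
  have h1 := Real.exp_one_gt_d9
  have h2 : Real.exp 5 = Real.exp 1 ^ 5 := by rw [← Real.exp_nat_mul]; norm_num
  rw [h2]
  calc (140 : ℝ) ≤ 2.7 ^ 5 := by norm_num
    _ ≤ _ := by gcongr; linarith

/-- The imaginary part of a period ratio is bounded in terms of the `j`-invariant. -/
lemma two_pi_im_le {E : WeierstrassCurve ℂ} [E.IsElliptic] {τ : ℍ} (h : IsUniformizedBy E τ) :
    2 * Real.pi * τ.im ≤ Real.exp 1.94 * (1 + Real.posLog ‖E.j‖) := by
  have hC := le_exp_mul
  have hp : 0 ≤ Real.posLog ‖E.j‖ := Real.posLog_nonneg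
  -- Up to 6.9 the factor e^1.94 suffices by itself. Beyond it |q| ≤ 1/900, and the lower bound for
  -- |j| gives 2π Im τ ≤ log 100 + log⁺|j|.
  by_cases hs : 2 * Real.pi * τ.im ≤ 6.9
  · nlinarith
  push Not at hs
  set s := 2 * Real.pi * τ.im with hs'
  have hr := norm_exp_two_pi_I_mul τ
  have h900 : Real.exp (-s) ≤ 1 / 900 := by
    have h1 : (900 : ℝ) ≤ Real.exp 6.9 := by
      have h2 : Real.exp 6.9 = Real.exp 5 * Real.exp 1.9 := by rw [← Real.exp_add]; norm_num
      have h3 : Real.exp 1.94 = Real.exp 1.9 * Real.exp 0.04 := by rw [← Real.exp_add]; norm_num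
      have h4 : Real.exp 0.04 ≤ 1 / (1 - 0.04) := by
        have := Real.exp_bound_div_one_sub_of_interval (x := 0.04) (by norm_num) (by norm_num)
        exact this
      have h6 : 0 < Real.exp 1.9 := Real.exp_pos _
      have h7 : (6.5 : ℝ) ≤ Real.exp 1.9 := by
        norm_num at h4 h3 hC ⊢
        nlinarith
      rw [h2]
      nlinarith [exp_five_gt]
    rw [Real.exp_neg, one_div]
    exact inv_anti₀ (by norm_num) (h1.trans (Real.exp_le_exp.2 hs.le))
  have hj := inv_le_norm_j h hr h900
  have h1 : s ≤ Real.log (100 * ‖E.j‖) := by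
    rw [Real.le_log_iff_exp_le]
    · have : Real.exp s * Real.exp (-s) = 1 := by rw [← Real.exp_add]; simp
      nlinarith [Real.exp_pos s]
    · by_contra! hc
      nlinarith [Real.exp_pos (-s)]
  have hj0 : ‖E.j‖ ≠ 0 := by
    intro h0
    rw [h0] at hj
    norm_num at hj
  rw [Real.log_mul (by norm_num) hj0] at h1
  have h2 : Real.log 100 ≤ 5 := by
    rw [Real.log_le_iff_le_exp (by norm_num)]
    linarith [exp_five_gt]
  have h3 : Real.log ‖E.j‖ ≤ Real.posLog ‖E.j‖ := by
    rw [Real.posLog]; exact le_max_right _ _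
  nlinarith

/-! ### The bound by the height -/

/-- Concavity of the logarithm, in the form needed for averages over the embeddings. -/
lemma sum_log_one_add_le {ι : Type*} (s : Finset ι) (f : ι → ℝ) (hf : ∀ i ∈ s, 0 ≤ f i) {H : ℝ}
    (hH : 0 ≤ H) (h : ∑ i ∈ s, f i ≤ s.card * H) :
    ∑ i ∈ s, Real.log (1 + f i) ≤ s.card * Real.log (1 + H) := by
  -- The tangent line of log at 1 + H lies above the graph; after summation the linear terms
  -- contribute at most 0.
  have h1 : ∀ i ∈ s, Real.log (1 + f i) ≤ Real.log (1 + H) + ((1 + f i) / (1 + H) - 1) := by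
    intro i hi
    have h2 := hf i hi
    have := Real.log_le_sub_one_of_pos (x := (1 + f i) / (1 + H)) (by positivity)
    rw [Real.log_div (by positivity) (by positivity)] at this
    linarith
  refine (Finset.sum_le_sum h1).trans ?_
  rw [Finset.sum_add_distrib, Finset.sum_const, nsmul_eq_mul, Finset.sum_sub_distrib,
    ← Finset.sum_div, Finset.sum_add_distrib]
  simp only [Finset.sum_const, nsmul_eq_mul, mul_one]
  have : (s.card + ∑ i ∈ s, f i) / (1 + H) ≤ s.card := by
    rw [div_le_iff₀ (by positivity)]
    linarith
  linarith

lemma alpha_le_log_height {K : Type*} [Field K] [NumberField K] (E : WeierstrassCurve K)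
    [E.IsElliptic] (τ₁ τ₂ : (K →+* ℂ) → ℍ) (h₁ : ∀ σ, IsUniformizedBy (E.map σ) (τ₁ σ))
    (h₂ : ∀ σ, τ₂ σ ∈ 𝒟) :
    alpha τ₁ τ₂ ≤ 1 / 2 * Real.log (1 + weilHeight E.j) + 0.97
      - 1 / 2 * Real.log (2 * Real.pi) - 1 / 2 * Real.log (Real.sqrt 3 / 2) := by
  have hd : (0 : ℝ) < Module.finrank ℚ K := by exact_mod_cast Module.finrank_pos
  have hcard : (Finset.univ : Finset (K →+* ℂ)).card = Module.finrank ℚ K := by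
    rw [Finset.card_univ, NumberField.Embeddings.card]
  set d : ℝ := ((Module.finrank ℚ K : ℕ) : ℝ) with hd'
  have hsum := sum_logPlus_embeddings_le E.j
  have hH : 0 ≤ weilHeight E.j := by
    have : 0 ≤ ∑ σ : K →+* ℂ, Real.posLog ‖σ E.j‖ :=
      Finset.sum_nonneg fun _ _ => Real.posLog_nonneg
    rw [weilHeight]
    have := this.trans hsum
    positivity
  have hdH : d * weilHeight E.j = Height.logHeight₁ E.j := by
    rw [weilHeight, ← hd']
    field_simp
  have hjensen := sum_log_one_add_le Finset.univ (fun σ : K →+* ℂ => Real.posLog ‖σ E.j‖)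
    (fun _ _ => Real.posLog_nonneg) hH (by rw [hcard, ← hd', hdH]; exact hsum)
  rw [hcard, ← hd'] at hjensen
  have hterm : ∀ σ : K →+* ℂ, Real.log ((τ₁ σ).im / (τ₂ σ).im) ≤
      Real.log (1 + Real.posLog ‖σ E.j‖) +
        (1.94 - Real.log (2 * Real.pi) - Real.log (Real.sqrt 3 / 2)) := by
    intro σ
    have hpl : 0 ≤ Real.posLog ‖σ E.j‖ := Real.posLog_nonneg
    have i1 := (τ₁ σ).im_pos
    have i2 := (τ₂ σ).im_pos
    have e1 := two_pi_im_le (h₁ σ)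
    rw [WeierstrassCurve.map_j] at e1
    have e2 := Real.log_le_log (by positivity) e1
    rw [Real.log_mul (by positivity) i1.ne', Real.log_mul (Real.exp_ne_zero _) (by positivity),
      Real.log_exp] at e2
    -- The lowest points of the fundamental domain are its corners, at height √3/2.
    have e3 : Real.sqrt 3 / 2 ≤ (τ₂ σ).im := by
      have := ModularGroup.three_le_four_mul_im_sq_of_mem_fd (h₂ σ)
      have : Real.sqrt 3 ≤ 2 * (τ₂ σ).im := Real.sqrt_le_iff.2 ⟨by positivity, by linarith⟩
      linarith
    have e4 := Real.log_le_log (by positivity) e3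
    rw [Real.log_div i1.ne' i2.ne']
    linarith
  have htot := Finset.sum_le_sum fun σ (_ : σ ∈ Finset.univ) => hterm σ
  rw [Finset.sum_add_distrib, Finset.sum_const, hcard, nsmul_eq_mul, ← hd'] at htot
  rw [alpha, ← hd', one_div, inv_mul_le_iff₀ (by positivity)]
  linarith

end EllipticAlpha

/-- Let `E₁`, `E₂` be elliptic curves over a number field `K`, let `φ` be an isogeny from `E₁` to `E₂`
defined over the algebraic closure of `K`, and for every complex embedding `σ` of `K` let `τ₁ σ`,
`τ₂ σ` be the reduced period ratios of `E₁`, `E₂` with respect to `σ`. -/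
theorem proposition2p6 {K : Type*} [Field K] [NumberField K]
    (E₁ E₂ : WeierstrassCurve K) [E₁.IsElliptic] [E₂.IsElliptic]
    (φ : EllipticAlpha.Isogeny (E₁.baseChange (AlgebraicClosure K))
      (E₂.baseChange (AlgebraicClosure K)))
    (τ₁ τ₂ : (K →+* ℂ) → UpperHalfPlane)
    (hτ₁ : ∀ σ : K →+* ℂ, EllipticAlpha.IsReducedFor (E₁.map σ) (τ₁ σ))
    (hτ₂ : ∀ σ : K →+* ℂ, EllipticAlpha.IsReducedFor (E₂.map σ) (τ₂ σ)) :
    EllipticAlpha.alpha τ₁ τ₂ ≤ 1 / 2 * Real.log (φ.degree : ℝ) ∧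
    EllipticAlpha.alpha τ₁ τ₂ ≤
      1 / 2 * Real.log (1 + EllipticAlpha.weilHeight E₁.j) + 0.97
        - 1 / 2 * Real.log (2 * Real.pi) - 1 / 2 * Real.log (Real.sqrt 3 / 2) := by
  exact ⟨EllipticAlpha.alpha_le_log_degree E₁ E₂ φ τ₁ τ₂ (fun σ => (hτ₁ σ).2.1)
    (fun σ => (hτ₂ σ).2.1) (fun σ => (hτ₂ σ).1),
    EllipticAlpha.alpha_le_log_height E₁ τ₁ τ₂ (fun σ => (hτ₁ σ).2.1) (fun σ => (hτ₂ σ).1)⟩
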